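/- **Setting.** Let $M\ge 2$, $S\ge 0$, and let $\mathcal G$ be a connected simple graph on $\{1,\dots,M\}$ with edge set $\mathcal E$, degrees $d_i$, average degree $\bar d=\frac1M\sum_i d_i$ and $P=\mathrm{diag}(d_1,\dots,d_M)$. Let $f_1,\dots,f_M:\mathbb R^S\to\mathbb R$ be differentiable with $\|\nabla f_i(x)-\nabla f_i(z)\|\le L_i\|x-z\|$ for all $x,z$, where $L_i>0$, and let $f(x)=\frac1M\sum_i f_i(x_i)$, $x=(x_1,\dots,x_M)\in(\mathbb R^S)^M$, satisfy $\underline f:=\inf f>-\infty$. Put $L=\mathrm{diag}(L_1,\dots,L_M)$, $L_{\max}=\max_i L_i$, $L_{\min}=\min_i L_i$, $d_0=(\nabla f_1(0),\dots,\nabla f_M(0))$ and $\|d_0\|_{L^{-1}}^2=\sum_i\|\nabla f_i(0)\|^2/L_i$. Let $F\in\mathbb R^{\mathcal E\times M}$ be the incidence matrix (the row of an edge $\{i,j\}$, $i>j$, has entry $1$ at $i$ and $-1$ at $j$), and let $K\in\mathbb R^{\mathcal E\times\mathcal E}$ be diagonal with entry $\sqrt{L_iL_j}$ at $\{i,j\}$.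 Define $$\widetilde{\mathcal L}=L^{-1/2}P^{-1/2}F^\top KFP^{-1/2}L^{-1/2},\qquad \widehat{\mathcal L}=L^{-1/2}F^\top KFL^{-1/2}.$$ $\lambda_{\max},\lambda_{\min},\underline\lambda_{\min}$ denote the largest, smallest and smallest nonzero eigenvalue. Write $\xi=\underline\lambda_{\min}/\lambda_{\max}$ for $\widetilde{\mathcal L},\widehat{\mathcal L}$, and $\xi=\lambda_{\min}/\lambda_{\max}$ for the matrices $R$, $\Upsilon^2$, $\Upsilon^2R$ below. $M\times M$ and $\mathcal E\times M$ matrices act on $(\mathbb R^S)^M$ blockwise. **Algorithm (xFILTER).** The parameters are diagonal matrices $\Sigma=\mathrm{diag}(\sigma_e)\succ0$ on $\mathcal E$ and $\Upsilon=\mathrm{diag}(\beta_i)\succ0$. Put $R=\Upsilon^{-2}F^\top\Sigma^2F+I$, $\theta=\xi(\Upsilon^2R)\,\xi(\Upsilon^2)\min\{1,\lambda_{\min}(\Upsilon^2)\}$, $$Q=\Big\lceil \tfrac14\ln\Big(\tfrac{16+128M\max\{\lambda_{\max}(\Upsilon^2R),1\}}{\theta^2}\Big)\sqrt{1/\xi(R)}\Big\rceil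 ,$$ $\tau=\frac{2}{\lambda_{\min}(R)+\lambda_{\max}(R)}$, $\rho_0=\frac{1-\xi(R)}{1+\xi(R)}$, $\alpha_1=2$, $\alpha_{t+1}=\frac{4}{4-\rho_0^2\alpha_t}$. Start with $x^{-1}=0$, $d^{-1}=-\Upsilon^{-2}\nabla f(0)$. For $r\ge-1$ run the $Q$ inner iterations $u_0=x^r$, $u_1=(I-\tau R)u_0+\tau d^r$, $u_q=\alpha_q(I-\tau R)u_{q-1}+(1-\alpha_q)u_{q-2}+\tau\alpha_q d^r$ ($2\le q\le Q$), set $x^{r+1}=u_Q$, $\tilde x^{s}=x^{s}-\Upsilon^{-2}\nabla f(x^{s})$, and $d^{r+1}=d^r+(\tilde x^{r+1}-\tilde x^r)-\Upsilon^{-2}F^\top\Sigma^2Fx^{r+1}$. For $T_r\ge1$ put $$e(T_r)=\min_{1\le r\le T_r}\Big(\Big\|\tfrac1M\sum_{i}\nabla f_i(x_i^r)\Big\|^2+\|\Sigma Fx^r\|^2\Big),$$ and let $T=Q(T_r+1)$ be the total number of inner iterations that generate $x^0,\dots,x^{T_r}$. We say that *$e\le\varepsilon$ is reached within $N$ iterations*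 if there is $T_r\ge1$ with $e(T_r)\le\varepsilon$ and $T\le\max\{N,2Q\}$ ($2Q$ is the cost of $x^0$ and $x^1$, the least for which $e$ is defined). Let $\tilde\kappa=1/\underline\lambda_{\min}(\Sigma F\Upsilon^{-2}F^\top\Sigma)$, $\tilde c=8\tilde\kappa$, and consider the parameter conditions $$\Upsilon^2\succeq\tfrac1{M^2}L\Upsilon^{-2}L,\qquad \big(\tfrac14-3\tilde\kappa-\tilde c\big)\Upsilon^2R-(1+2\tilde c)\tfrac LM-\tfrac{6\tilde\kappa}{M^2}L\Upsilon^{-2}L\succeq0. \tag{$*$}$$ Put $\widetilde C_1=f(x^0)-\underline f+\frac5M\|d_0\|^2_{L^{-1}}$ and $\widetilde C_2=128\big(\sum_i\beta_i^2+3+\frac1{32\tilde\kappa}\big)$. **Theorem.** *Case I.* Let $k>0$ satisfy $kP\succeq\bar d I$, and choose $\Sigma^2=\frac{48\cdot96\,k}{\underline\lambda_{\min}(\widetilde{\mathcal L})\sum_id_i}K$, $\Upsilon^2=\frac{96k}{\sum_id_i}P^{1/2}LP^{1/2}$. Then $(*)$ holds, $\widetilde C_2\le128\big(\frac{96k}{\sum_id_i}\sum_id_iL_i+19\big)$,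 and for every $\varepsilon>0$, $e\le\varepsilon$ is reached within $$\frac{\widetilde C_1\widetilde C_2}{\varepsilon}\cdot\frac14\ln\Big(\frac{16+128M\max\{\lambda_{\max}(\Upsilon^2R),1\}}{\theta^2}\Big)\sqrt{1/\xi(R)}$$ iterations, and also within $$\frac{\widetilde C_1\widetilde C_2}{\varepsilon}\cdot\frac14\ln\Big(\frac{50^2(ML_{\max}/L_{\min})^4\,(16+128M\max\{50\cdot96\,kL_{\max},1\})}{\xi^3(\widetilde{\mathcal L})\min\{1,96^2k^2L_{\min}^2/M^2\}}\Big)\sqrt{50/\xi(\widetilde{\mathcal L})}$$ iterations. *Case II.* For an arbitrary connected graph choose $\Sigma^2=\frac{48\cdot96}{M\underline\lambda_{\min}(\widehat{\mathcal L})}K$, $\Upsilon^2=\frac{96}{M}L$. Then $(*)$ holds, $\widetilde C_2\le128\big(\frac{96}{M}\sum_iL_i+19\big)$, and for every $\varepsilon>0$, $e\le\varepsilon$ is reached within $$\frac{\widetilde C_1\widetilde C_2}{\varepsilon}\cdot\frac14\ln\Big(\frac{50^2(L_{\max}/L_{\min})^4\,(16+128M\max\{50\cdot96\,L_{\max}/M,1\})}{\xi^3(\widehat{\mathcal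 L})\min\{1,96^2L_{\min}^2/M^2\}}\Big)\sqrt{50/\xi(\widehat{\mathcal L})}$$ iterations. -/

import Mathlib

open Matrix

namespace XFilter

noncomputable section

/-! ### Extreme eigenvalues -/

/-- The largest (real) eigenvalue of a square matrix. -/
def eigMax {n : Type*} [Fintype n] [DecidableEq n] (A : Matrix n n ℝ) : ℝ :=
  sSup (spectrum ℝ A)

/-- The smallest (real) eigenvalue of a square matrix. -/
def eigMin {n : Type*} [Fintype n] [DecidableEq n] (A : Matrix n n ℝ) : ℝ :=
  sInf (spectrum ℝ A)

/-- The smallest nonzero (real) eigenvalue of a square matrix. -/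
def eigMinNonzero {n : Type*} [Fintype n] [DecidableEq n] (A : Matrix n n ℝ) : ℝ :=
  sInf (spectrum ℝ A \ {0})

/-- The ratio of the smallest to the largest eigenvalue (for `R`, `Υ²`, `Υ² R`). -/
def eigRatio {n : Type*} [Fintype n] [DecidableEq n] (A : Matrix n n ℝ) : ℝ :=
  eigMin A / eigMax A

/-- The spectral gap of a Laplacian-type matrix: the ratio of its smallest nonzero eigenvalue to
its largest eigenvalue. -/
def spectralGap {n : Type*} [Fintype n] [DecidableEq n] (A : Matrix n n ℝ) : ℝ :=
  eigMinNonzero A / eigMax A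

/-! ### The problem class -/

/-- The component variables: `S`-dimensional Euclidean space. -/
abbrev Vec (S : ℕ) := EuclideanSpace ℝ (Fin S)

/-- The objective `f(x) = (1/M) ∑ᵢ fᵢ(xᵢ)` of `M` local variables. -/
def objective {M S : ℕ} (f : Fin M → Vec S → ℝ) (x : Fin M → Vec S) : ℝ :=
  (1 / (M : ℝ)) * ∑ i, f i (x i)

/-- The infimum of the objective over all local variables. -/
def objectiveInf {M S : ℕ} (f : Fin M → Vec S → ℝ) : ℝ :=
  ⨅ x : Fin M → Vec S, objective f x

/-- The gradient of the objective; its `i`-th block is `(1/M) ∇fᵢ(xᵢ)`. -/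
def gradObjective {M S : ℕ} (f : Fin M → Vec S → ℝ) (x : Fin M → Vec S) : Fin M → Vec S :=
  fun i => (1 / (M : ℝ)) • gradient (f i) (x i)

/-- The problem class: every component function is differentiable with an `L i`-Lipschitz
gradient, `L i > 0`, and the objective is bounded below. -/
structure ProblemClass {M S : ℕ} (f : Fin M → Vec S → ℝ) (L : Fin M → ℝ) : Prop where
  differentiable : ∀ i, Differentiable ℝ (f i)
  lip_pos : ∀ i, 0 < L i
  lip_gradient : ∀ i, ∀ x z : Vec S, ‖gradient (f i) x - gradient (f i) z‖ ≤ L i * ‖x - z‖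
  bddBelow : BddBelow (Set.range (objective f))

/-- `L_max`. -/
def lipMax {M : ℕ} (L : Fin M → ℝ) : ℝ := ⨆ i, L i

/-- `L_min`. -/
def lipMin {M : ℕ} (L : Fin M → ℝ) : ℝ := ⨅ i, L i

/-! ### Matrices attached to a graph -/

/-- A real matrix acting on a vector of blocks, that is, `(A ⊗ I_S) x`. -/
def act {m n : Type*} [Fintype n] {S : ℕ} (A : Matrix m n ℝ) (x : n → Vec S) : m → Vec S :=
  fun i => ∑ j, A i j • x j

/-- The squared Euclidean norm of a vector of blocks. -/
def sqNorm {m : Type*} [Fintype m] {S : ℕ} (x : m → Vec S) : ℝ := ∑ i, ‖x i‖ ^ 2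

/-- The average degree. -/
def avgDegree {M : ℕ} (G : SimpleGraph (Fin M)) [DecidableRel G.Adj] : ℝ :=
  (1 / (M : ℝ)) * ∑ i, (G.degree i : ℝ)

/-- The degree matrix `P`. -/
def degMatrix {M : ℕ} (G : SimpleGraph (Fin M)) [DecidableRel G.Adj] :
    Matrix (Fin M) (Fin M) ℝ :=
  diagonal fun i => (G.degree i : ℝ)

/-- `P^{1/2}`. -/
def degSqrt {M : ℕ} (G : SimpleGraph (Fin M)) [DecidableRel G.Adj] :
    Matrix (Fin M) (Fin M) ℝ :=
  diagonal fun i => Real.sqrt (G.degree i)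

/-- `P^{-1/2}`. -/
def degInvSqrt {M : ℕ} (G : SimpleGraph (Fin M)) [DecidableRel G.Adj] :
    Matrix (Fin M) (Fin M) ℝ :=
  diagonal fun i => 1 / Real.sqrt (G.degree i)

/-- The degree-normalized incidence matrix `A`: the row of an edge `{i, j}` with `i > j` has the
entry `1/√dᵢ` at `i`, the entry `-1/√dⱼ` at `j`, and zeros elsewhere. -/
def incidence {M : ℕ} (G : SimpleGraph (Fin M)) [DecidableRel G.Adj] :
    Matrix G.edgeSet (Fin M) ℝ :=
  fun e v =>
    if v = (e : Sym2 (Fin M)).sup then 1 / Real.sqrt (G.degree v)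
    else if v = (e : Sym2 (Fin M)).inf then -(1 / Real.sqrt (G.degree v))
    else 0

/-- The scaled incidence matrix `F = A P^{1/2}`. -/
def scaledIncidence {M : ℕ} (G : SimpleGraph (Fin M)) [DecidableRel G.Adj] :
    Matrix G.edgeSet (Fin M) ℝ :=
  incidence G * degSqrt G

/-- The diagonal matrix `L` of the Lipschitz constants. -/
def lipMatrix {M : ℕ} (L : Fin M → ℝ) : Matrix (Fin M) (Fin M) ℝ := diagonal L

/-- `L^{-1/2}`. -/
def lipInvSqrt {M : ℕ} (L : Fin M → ℝ) : Matrix (Fin M) (Fin M) ℝ :=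
  diagonal fun i => 1 / Real.sqrt (L i)

/-- The diagonal edge matrix `K`, with entry `√(Lᵢ Lⱼ)` at the edge `{i, j}`. -/
def edgeLip {M : ℕ} (G : SimpleGraph (Fin M)) (L : Fin M → ℝ) :
    Matrix G.edgeSet G.edgeSet ℝ :=
  diagonal fun e => Real.sqrt (L (e : Sym2 (Fin M)).sup * L (e : Sym2 (Fin M)).inf)

/-- `L̃ = L^{-1/2} P^{-1/2} Fᵀ K F P^{-1/2} L^{-1/2}`. -/
def tildeLaplacian {M : ℕ} (G : SimpleGraph (Fin M)) [DecidableRel G.Adj] (L : Fin M → ℝ) :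
    Matrix (Fin M) (Fin M) ℝ :=
  lipInvSqrt L * degInvSqrt G * (scaledIncidence G)ᵀ * edgeLip G L * scaledIncidence G *
    degInvSqrt G * lipInvSqrt L

/-- `L̂ = L^{-1/2} Fᵀ K F L^{-1/2}`. -/
def hatLaplacian {M : ℕ} (G : SimpleGraph (Fin M)) [DecidableRel G.Adj] (L : Fin M → ℝ) :
    Matrix (Fin M) (Fin M) ℝ :=
  lipInvSqrt L * (scaledIncidence G)ᵀ * edgeLip G L * scaledIncidence G * lipInvSqrt L

/-! ### The parameters of the algorithm

`σ` and `β` are the diagonals of the matrices `Σ` and `Υ`. -/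

/-- `Σ²`. -/
def sigmaSq {M : ℕ} {G : SimpleGraph (Fin M)} (σ : G.edgeSet → ℝ) :
    Matrix G.edgeSet G.edgeSet ℝ :=
  diagonal fun e => σ e ^ 2

/-- `Υ²`. -/
def upsilonSq {M : ℕ} (β : Fin M → ℝ) : Matrix (Fin M) (Fin M) ℝ :=
  diagonal fun i => β i ^ 2

/-- `Υ⁻²`. -/
def upsilonInvSq {M : ℕ} (β : Fin M → ℝ) : Matrix (Fin M) (Fin M) ℝ :=
  diagonal fun i => 1 / β i ^ 2

/-- `R = Υ⁻² Fᵀ Σ² F + I`. -/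
def filterMatrix {M : ℕ} (G : SimpleGraph (Fin M)) [DecidableRel G.Adj]
    (σ : G.edgeSet → ℝ) (β : Fin M → ℝ) : Matrix (Fin M) (Fin M) ℝ :=
  upsilonInvSq β * (scaledIncidence G)ᵀ * sigmaSq σ * scaledIncidence G + 1

/-- `κ̃ = 1 / λ(Σ F Υ⁻² Fᵀ Σ)`, with `λ` the smallest nonzero eigenvalue. -/
def kappaTilde {M : ℕ} (G : SimpleGraph (Fin M)) [DecidableRel G.Adj]
    (σ : G.edgeSet → ℝ) (β : Fin M → ℝ) : ℝ :=
  1 / eigMinNonzero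
    (diagonal σ * scaledIncidence G * upsilonInvSq β * (scaledIncidence G)ᵀ * diagonal σ)

/-- The conditions on the parameters, with `c̃ = 8 κ̃`:
`Υ² ⪰ L Υ⁻² L / M²` and
`(1/4 - 3κ̃ - c̃) Υ² R - (1 + 2c̃) L/M - (6κ̃/M²) L Υ⁻² L ⪰ 0`. -/
def ParameterConditions {M : ℕ} (G : SimpleGraph (Fin M)) [DecidableRel G.Adj]
    (L : Fin M → ℝ) (σ : G.edgeSet → ℝ) (β : Fin M → ℝ) : Prop :=
  let κ := kappaTilde G σ β
  let c := 8 * κ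
  (upsilonSq β - (1 / (M : ℝ) ^ 2) • (lipMatrix L * upsilonInvSq β * lipMatrix L)).PosSemidef ∧
  ((1 / 4 - 3 * κ - c) • (upsilonSq β * filterMatrix G σ β)
    - ((1 + 2 * c) / (M : ℝ)) • lipMatrix L
    - (6 * κ / (M : ℝ) ^ 2) • (lipMatrix L * upsilonInvSq β * lipMatrix L)).PosSemidef

/-- `θ = ξ(Υ² R) ξ(Υ²) min{1, λ_min(Υ²)}`. -/
def thetaConst {M : ℕ} (G : SimpleGraph (Fin M)) [DecidableRel G.Adj]
    (σ : G.edgeSet → ℝ) (β : Fin M → ℝ) : ℝ :=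
  eigRatio (upsilonSq β * filterMatrix G σ β) * eigRatio (upsilonSq β) *
    min 1 (eigMin (upsilonSq β))

/-- The prescribed number `Q` of inner iterations: the least natural number that is at least
`-(1/4) ln(θ² / (16 + 128 M max{λ_max(Υ² R), 1})) √(1/ξ(R))`. -/
def innerCount {M : ℕ} (G : SimpleGraph (Fin M)) [DecidableRel G.Adj]
    (σ : G.edgeSet → ℝ) (β : Fin M → ℝ) : ℕ :=
  ⌈-(1 / 4) * Real.log (thetaConst G σ β ^ 2 /
      (16 + 128 * (M : ℝ) * max (eigMax (upsilonSq β * filterMatrix G σ β)) 1)) *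
    Real.sqrt (1 / eigRatio (filterMatrix G σ β))⌉₊

/-! ### The algorithm -/

/-- The Chebyshev weights: `α₁ = 2`, `α_{t+1} = 4 / (4 - ρ² α_t)` (the value at `0` is not used). -/
def chebWeight (ρ : ℝ) : ℕ → ℝ
  | 0 => 0
  | 1 => 2
  | t + 2 => 4 / (4 - ρ ^ 2 * chebWeight ρ (t + 1))

/-- The inner (Chebyshev) iteration `u_q` for the system `R x = d`, started at `u₀`. -/
def chebIter {M S : ℕ} (R : Matrix (Fin M) (Fin M) ℝ) (τ ρ : ℝ) (u₀ d : Fin M → Vec S) :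
    ℕ → Fin M → Vec S
  | 0 => u₀
  | 1 => act (1 - τ • R) u₀ + τ • d
  | q + 2 =>
      chebWeight ρ (q + 2) • act (1 - τ • R) (chebIter R τ ρ u₀ d (q + 1)) +
        (1 - chebWeight ρ (q + 2)) • chebIter R τ ρ u₀ d q +
        (τ * chebWeight ρ (q + 2)) • d

/-- The filtering step: `Q` inner iterations with `τ = 2 / (λ_min(R) + λ_max(R))` and
`ρ₀ = (1 - ξ(R)) / (1 + ξ(R))`. -/
def filterStep {M S : ℕ} (G : SimpleGraph (Fin M)) [DecidableRel G.Adj]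
    (σ : G.edgeSet → ℝ) (β : Fin M → ℝ) (Q : ℕ) (u₀ d : Fin M → Vec S) : Fin M → Vec S :=
  let R := filterMatrix G σ β
  chebIter R (2 / (eigMin R + eigMax R)) ((1 - eigRatio R) / (1 + eigRatio R)) u₀ d Q

/-- The prediction step `x̃ = x - Υ⁻² ∇f(x)`. -/
def predict {M S : ℕ} (f : Fin M → Vec S → ℝ) (β : Fin M → ℝ) (x : Fin M → Vec S) :
    Fin M → Vec S :=
  x - act (upsilonInvSq β) (gradObjective f x)

/-- The state `(x^r, d^r)` of xFILTER, with `state n` standing for `r = n - 1`: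
`x^{-1} = 0`, `d^{-1} = -Υ⁻² ∇f(x^{-1})`, then filtering, prediction and tracking. -/
def state {M S : ℕ} (f : Fin M → Vec S → ℝ) (G : SimpleGraph (Fin M)) [DecidableRel G.Adj]
    (σ : G.edgeSet → ℝ) (β : Fin M → ℝ) (Q : ℕ) : ℕ → (Fin M → Vec S) × (Fin M → Vec S)
  | 0 => (0, -act (upsilonInvSq β) (gradObjective f 0))
  | n + 1 =>
      let x := (state f G σ β Q n).1
      let d := (state f G σ β Q n).2
      let y := filterStep G σ β Q x d
      (y, d + (predict f β y - predict f β x) -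
        act (upsilonInvSq β * (scaledIncidence G)ᵀ * sigmaSq σ * scaledIncidence G) y)

/-- The outer iterate `x^r`, `r ≥ 0`, of xFILTER with the prescribed inner iteration number. -/
def iterate {M S : ℕ} (f : Fin M → Vec S → ℝ) (G : SimpleGraph (Fin M)) [DecidableRel G.Adj]
    (σ : G.edgeSet → ℝ) (β : Fin M → ℝ) (r : ℕ) : Fin M → Vec S :=
  (state f G σ β (innerCount G σ β) (r + 1)).1

/-- The number of inner iterations (communication rounds) performed to generate `x^0, …, x^r`:
each of these `r + 1` iterates takes `Q`. -/
def totalIterations {M : ℕ} (G : SimpleGraph (Fin M)) [DecidableRel G.Adj]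
    (σ : G.edgeSet → ℝ) (β : Fin M → ℝ) (r : ℕ) : ℕ :=
  innerCount G σ β * (r + 1)

/-- `e(T) = min_{r ∈ {1, …, T}} ‖(1/M) ∑ᵢ ∇fᵢ(xᵢ^r)‖² + ‖Σ F x^r‖²`. -/
def errorMeasure {M S : ℕ} (f : Fin M → Vec S → ℝ) (G : SimpleGraph (Fin M))
    [DecidableRel G.Adj] (σ : G.edgeSet → ℝ) (β : Fin M → ℝ) (T : ℕ) : ℝ :=
  ⨅ r : Set.Icc 1 T,
    ‖(1 / (M : ℝ)) • ∑ i, gradient (f i) (iterate f G σ β r i)‖ ^ 2 +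
      sqNorm (act (diagonal σ * scaledIncidence G) (iterate f G σ β r))

/-! ### The constants in the bounds -/

/-- `C̃₁ = f(x⁰) - inf f + (5/M) ‖d₀‖²_{L⁻¹}`, where `d₀ = (∇f₁(0), …, ∇f_M(0))`. -/
def constOne {M S : ℕ} (f : Fin M → Vec S → ℝ) (G : SimpleGraph (Fin M)) [DecidableRel G.Adj]
    (L : Fin M → ℝ) (σ : G.edgeSet → ℝ) (β : Fin M → ℝ) : ℝ :=
  objective f (iterate f G σ β 0) - objectiveInf f +
    (5 / (M : ℝ)) * ∑ i, ‖gradient (f i) 0‖ ^ 2 / L i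

/-- `C̃₂ = 128 (∑ᵢ βᵢ² + 3 + 1/(32 κ̃))`. -/
def constTwo {M : ℕ} (G : SimpleGraph (Fin M)) [DecidableRel G.Adj]
    (σ : G.edgeSet → ℝ) (β : Fin M → ℝ) : ℝ :=
  128 * (∑ i, β i ^ 2 + 3 + 1 / (32 * kappaTilde G σ β))

/-- `e(T_r) ≤ ε` is reached at some outer iteration index `T_r ≥ 1` for which the total number of
inner iterations is at most `N`, or is the cost of `x^0` and `x^1` (the least cost for which the
error measure, a minimum over `1 ≤ r ≤ T_r`, is defined) if `N` is smaller than that. -/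
def ReachesWithin {M S : ℕ} (f : Fin M → Vec S → ℝ) (G : SimpleGraph (Fin M))
    [DecidableRel G.Adj] (σ : G.edgeSet → ℝ) (β : Fin M → ℝ) (ε N : ℝ) : Prop :=
  ∃ T : ℕ, 1 ≤ T ∧ errorMeasure f G σ β T ≤ ε ∧
    (totalIterations G σ β T : ℝ) ≤ max N (totalIterations G σ β 1)

end

end XFilter

/-! In the variables z = Υx the algorithm is an inexact proximal primal-dual method. Put h(z) =
f(Υ⁻¹z), g = ∇h, X = ΣFΥ⁻¹ and N = XᵀX. The matrix R is similar to the symmetric matrix N + 1, and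
by induction Υd = z - g(z) - Xᵀμ, where μ is the running sum of the vectors Xz. The inner loop
therefore solves g(zₙ) + Xᵀμₙ₊₁ + (zₙ₊₁ - zₙ) = 0 approximately. The parameter choices normalize two
constants: βᵢ² ≥ 96Lᵢ/M makes g 1/96-Lipschitz, and the choice of Σ² makes N the multiple of the
weighted Laplacian whose least nonzero eigenvalue is 48, so κ̃ = 1/48.

Inner loop: Q Chebyshev steps multiply the residual by at most 2 exp(-2Q/√λ_max(R))
(`norm_chebyshev_residual_le`), and the prescribed Q makes the square of this factor at most 1/17000
(`residual_factor_le`).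

Outer loop (`inexact_proximal_primal_dual`): the augmented Lagrangian at (zₙ, μₙ₋₁) decreases by
nearly the squared increment of z, up to the inexactness and the dual ascent term ‖Xzₙ‖². The latter
is at most ‖Nzₙ‖²/48, and Nzₙ is a difference of consecutive optimality conditions, hence controlled
by increments and residuals. Since this Lagrangian equals h(zₙ) + ‖μₙ‖²/2 - ‖μₙ₋₁‖²/2, its partial
sums telescope and are bounded below. Increments and residuals are thus square-summable with an
explicit bound. Pairing the optimality condition with β, which spans the image of consensus and lies
in ker X, removes μ and bounds the averaged gradient. The outcome is T e(T) ≤ C̃₁C̃₂/30.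

The factor 30 pays for rounding T and Q up and leaves a factor 2 in Q
(`reachesWithin_of_innerReal_le`). That factor 2 lets the explicit bounds replace the argument of
the logarithm by an upper bound for its square root (`innerReal_le`). -/

namespace XFilter

/-! ### Quadratic forms and extreme eigenvalues of symmetric matrices. -/

section QuadraticForm

variable {n : Type*} [Fintype n] {A : Matrix n n ℝ}

theorem dotProduct_self_pos' {v : n → ℝ} (hv : v ≠ 0) : 0 < v ⬝ᵥ v := by
  have := Matrix.dotProduct_star_self_pos_iff.2 hv
  simpa using this

theorem PosSemidef.quadForm_nonneg (hA : A.PosSemidef) (v : n → ℝ) : 0 ≤ v ⬝ᵥ A *ᵥ v := by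
  simpa using hA.dotProduct_mulVec_nonneg v

end QuadraticForm

section Spectrum

open scoped Pointwise

variable {n : Type*} [Fintype n] [DecidableEq n] {A : Matrix n n ℝ}

theorem exists_eigenvector {t : ℝ} (ht : t ∈ spectrum ℝ A) : 
    ∃ v : n → ℝ, v ≠ 0 ∧ A *ᵥ v = t • v := by
  rw [← Matrix.spectrum_toLin', ← Module.End.hasEigenvalue_iff_mem_spectrum] at ht
  obtain ⟨v, hv⟩ := ht.exists_hasEigenvector
  exact ⟨v, hv.2, by simpa using hv.apply_eq_smul⟩

theorem mem_spectrum_of_eigenvector {t : ℝ} {v : n → ℝ} (hv : v ≠ 0) (h : A *ᵥ v = t • v) :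
    t ∈ spectrum ℝ A := by
  rw [← Matrix.spectrum_toLin', ← Module.End.hasEigenvalue_iff_mem_spectrum]
  exact Module.End.hasEigenvalue_of_hasEigenvector
    ⟨Module.End.mem_eigenspace_iff.2 (by simpa using h), hv⟩

theorem eigMin_le {t : ℝ} (ht : t ∈ spectrum ℝ A) : eigMin A ≤ t :=
  csInf_le (Matrix.finite_spectrum A).bddBelow ht

theorem le_eigMax {t : ℝ} (ht : t ∈ spectrum ℝ A) : t ≤ eigMax A :=
  le_csSup (Matrix.finite_spectrum A).bddAbove ht

theorem eigMinNonzero_le {t : ℝ} (ht : t ∈ spectrum ℝ A) (h0 : t ≠ 0) : eigMinNonzero A ≤ t :=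
  csInf_le ((Matrix.finite_spectrum A).subset Set.sdiff_subset).bddBelow ⟨ht, h0⟩

theorem eigMinNonzero_mem (h : eigMinNonzero A ≠ 0) : eigMinNonzero A ∈ spectrum ℝ A \ {0} := by
  have hne : (spectrum ℝ A \ {0}).Nonempty := by
    rw [Set.nonempty_iff_ne_empty]
    intro he
    exact h (by rw [eigMinNonzero, he, Real.sInf_empty])
  exact hne.csInf_mem ((Matrix.finite_spectrum A).subset Set.sdiff_subset)

theorem eigMax_mem [Nonempty n] (hA : A.IsHermitian) : eigMax A ∈ spectrum ℝ A :=
  Set.Nonempty.csSup_mem (ContinuousFunctionalCalculus.spectrum_nonempty A hA)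
    (Matrix.finite_spectrum A)

theorem eigMin_mem [Nonempty n] (hA : A.IsHermitian) : eigMin A ∈ spectrum ℝ A :=
  Set.Nonempty.csInf_mem (ContinuousFunctionalCalculus.spectrum_nonempty A hA)
    (Matrix.finite_spectrum A)

theorem le_eigMin [Nonempty n] (hA : A.IsHermitian) {c : ℝ}
    (h : ∀ v : n → ℝ, c * (v ⬝ᵥ v) ≤ v ⬝ᵥ A *ᵥ v) : c ≤ eigMin A := by
  obtain ⟨v, hv, e⟩ := exists_eigenvector (eigMin_mem hA)
  have := h v
  rw [e, dotProduct_smul, smul_eq_mul] at this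
  exact le_of_mul_le_mul_right this (dotProduct_self_pos' hv)

theorem eigMax_le [Nonempty n] (hA : A.IsHermitian) {c : ℝ}
    (h : ∀ v : n → ℝ, v ⬝ᵥ A *ᵥ v ≤ c * (v ⬝ᵥ v)) : eigMax A ≤ c := by
  obtain ⟨v, hv, e⟩ := exists_eigenvector (eigMax_mem hA)
  have := h v
  rw [e, dotProduct_smul, smul_eq_mul] at this
  exact le_of_mul_le_mul_right this (dotProduct_self_pos' hv)

-- The continuous functional calculus turns scalar inequalities on the spectrum into matrix
-- inequalities; every spectral estimate below that is not read off an eigenvector comes from this.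
open MatrixOrder Polynomial in
theorem posSemidef_aeval (hA : A.IsHermitian) (p : ℝ[X])
    (hp : ∀ t ∈ spectrum ℝ A, 0 ≤ p.eval t) : (aeval A p).PosSemidef := by
  rw [← Matrix.nonneg_iff_posSemidef, ← cfc_polynomial p A hA]
  exact cfc_nonneg hp

theorem quadForm_le_eigMax (hA : A.IsHermitian) (v : n → ℝ) :
    v ⬝ᵥ A *ᵥ v ≤ eigMax A * (v ⬝ᵥ v) := by
  have h := PosSemidef.quadForm_nonneg
    (posSemidef_aeval hA (Polynomial.C (eigMax A) - Polynomial.X)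
      (fun t ht => by simpa using le_eigMax ht)) v
  simpa [Matrix.sub_mulVec, Algebra.algebraMap_eq_smul_one, Matrix.smul_mulVec] using h

theorem eigMin_le_quadForm (hA : A.IsHermitian) (v : n → ℝ) :
    eigMin A * (v ⬝ᵥ v) ≤ v ⬝ᵥ A *ᵥ v := by
  have h := PosSemidef.quadForm_nonneg
    (posSemidef_aeval hA (Polynomial.X - Polynomial.C (eigMin A))
      (fun t ht => by simpa using eigMin_le ht)) v
  simpa [Matrix.sub_mulVec, Algebra.algebraMap_eq_smul_one, Matrix.smul_mulVec] using h

/-- A symmetric matrix with spectrum in `[a, b]` satisfies `(A - a)(b - A) ⪰ 0`. -/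
theorem posSemidef_sub_mul_sub (hA : A.IsHermitian) {a b : ℝ}
    (h : ∀ t ∈ spectrum ℝ A, a ≤ t ∧ t ≤ b) :
    ((A - a • (1 : Matrix n n ℝ)) * (b • (1 : Matrix n n ℝ) - A)).PosSemidef := by
  have h := posSemidef_aeval hA
    ((Polynomial.X - Polynomial.C a) * (Polynomial.C b - Polynomial.X))
      (fun t ht => by
        simpa using mul_nonneg (sub_nonneg.2 (h t ht).1) (sub_nonneg.2 (h t ht).2))
  simpa [Algebra.algebraMap_eq_smul_one] using h

/-- A positive semidefinite matrix satisfies `A² ⪰ m A` with `m` its least nonzero eigenvalue. -/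
theorem posSemidef_mul_self_sub (hA : A.PosSemidef) :
    (A * A - eigMinNonzero A • A).PosSemidef := by
  have h := posSemidef_aeval hA.1
    (Polynomial.X * Polynomial.X - Polynomial.C (eigMinNonzero A) * Polynomial.X)
      (fun t ht => by
        have h0 : 0 ≤ t := by
          obtain ⟨v, hv, e⟩ := exists_eigenvector ht
          have := PosSemidef.quadForm_nonneg hA v
          rw [e, dotProduct_smul, smul_eq_mul] at this
          exact nonneg_of_mul_nonneg_left this (dotProduct_self_pos' hv)
        rcases h0.eq_or_lt with rfl | h1
        · simp
        · have := eigMinNonzero_le ht h1.ne'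
          simp
          nlinarith)
  simpa [Algebra.algebraMap_eq_smul_one] using h

theorem spectrum_smul_matrix {c : ℝ} (hc : c ≠ 0) :
    spectrum ℝ (c • A) = (fun t => c * t) '' spectrum ℝ A := by
  ext t
  constructor
  · intro h
    obtain ⟨v, hv, e⟩ := exists_eigenvector h
    refine ⟨c⁻¹ * t, mem_spectrum_of_eigenvector hv ?_, by field_simp⟩
    rw [mul_smul, ← e, Matrix.smul_mulVec, smul_smul, inv_mul_cancel₀ hc, one_smul]
  · rintro ⟨s, hs, rfl⟩
    obtain ⟨v, hv, e⟩ := exists_eigenvector hs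
    exact mem_spectrum_of_eigenvector hv (by rw [Matrix.smul_mulVec, e, smul_smul])

theorem eigMinNonzero_smul {c : ℝ} (hc : 0 < c) :
    eigMinNonzero (c • A) = c * eigMinNonzero A := by
  have : spectrum ℝ (c • A) \ {0} = c • (spectrum ℝ A \ {0}) := by
    rw [spectrum_smul_matrix hc.ne']
    ext t
    simp only [Set.mem_sdiff, Set.mem_image, Set.mem_singleton_iff, Set.mem_smul_set, smul_eq_mul]
    constructor
    · rintro ⟨⟨s, hs, rfl⟩, h0⟩
      exact ⟨s, ⟨hs, right_ne_zero_of_mul h0⟩, rfl⟩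
    · rintro ⟨s, ⟨hs, h0⟩, rfl⟩
      exact ⟨⟨s, hs, rfl⟩, mul_ne_zero hc.ne' h0⟩
  rw [eigMinNonzero, this, Real.sInf_smul_of_nonneg hc.le, smul_eq_mul, eigMinNonzero]

theorem eigMax_smul {c : ℝ} (hc : 0 < c) : eigMax (c • A) = c * eigMax A := by
  have : spectrum ℝ (c • A) = c • spectrum ℝ A := spectrum_smul_matrix hc.ne'
  rw [eigMax, this, Real.sSup_smul_of_nonneg hc.le, smul_eq_mul, eigMax]

theorem mem_spectrum_mul_comm {m : Type*} [Fintype m] [DecidableEq m]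
    {X : Matrix m n ℝ} {Y : Matrix n m ℝ} {t : ℝ} (ht : t ∈ spectrum ℝ (X * Y) \ {0}) :
    t ∈ spectrum ℝ (Y * X) \ {0} := by
  obtain ⟨ht, h0⟩ := ht
  obtain ⟨v, hv, e⟩ := exists_eigenvector ht
  rw [← Matrix.mulVec_mulVec] at e
  refine ⟨mem_spectrum_of_eigenvector (v := Y *ᵥ v) ?_ ?_, h0⟩
  · intro h
    rw [h, Matrix.mulVec_zero] at e
    exact (smul_ne_zero h0 hv) e.symm
  · rw [← Matrix.mulVec_mulVec, e, Matrix.mulVec_smul]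

/-- `X Y` and `Y X` have the same nonzero eigenvalues. -/
theorem eigMinNonzero_mul_comm {m : Type*} [Fintype m] [DecidableEq m]
    (X : Matrix m n ℝ) (Y : Matrix n m ℝ) : eigMinNonzero (X * Y) = eigMinNonzero (Y * X) := by
  have : spectrum ℝ (X * Y) \ {0} = spectrum ℝ (Y * X) \ {0} :=
    Set.Subset.antisymm (fun _ => mem_spectrum_mul_comm) (fun _ => mem_spectrum_mul_comm)
  rw [eigMinNonzero, eigMinNonzero, this]

end Spectrum

end XFilter

namespace XFilter

/-! ### Chebyshev iteration for a symmetric operator. -/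

section Chebyshev

/-- The Chebyshev polynomials of a symmetric contraction are contractions. -/
theorem norm_chebyshev_le {E : Type*} [NormedAddCommGroup E] [InnerProductSpace ℝ E]
    (N : E →ₗ[ℝ] E) (hN : N.IsSymmetric) (hN1 : ∀ x, ‖N x‖ ≤ ‖x‖) (v : ℕ → E)
    (h1 : v 1 = N (v 0)) (h2 : ∀ q, v (q + 2) = (2 : ℝ) • N (v (q + 1)) - v q) (q : ℕ) :
    ‖v q‖ ≤ ‖v 0‖ := by
  -- Here v q = T_q(N) v₀ and s = U_{q-1}(N) v₀. The clauses are T_{q+1} = x T_q - (1 - x²) U_{q-1}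
  -- and the Pell identity T_q² + (1 - x²) U_{q-1}² = 1, so no diagonalization is needed.
  have key : ∀ q, ∃ s : E, v (q + 1) = N (v q) - (s - N (N s)) ∧
      ‖v q‖ ^ 2 + (‖s‖ ^ 2 - ‖N s‖ ^ 2) = ‖v 0‖ ^ 2 := by
    intro q
    induction q with
    | zero => exact ⟨0, by simp [h1], by simp⟩
    | succ q ih =>
      obtain ⟨s, hs, he⟩ := ih
      -- This is the recursion U_q = x U_{q-1} + T_q.
      refine ⟨N s + v q, ?_, ?_⟩
      · rw [h2, hs]
        simp only [map_sub, map_add, two_smul]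
        abel
      · have e1 := hN (N s) s
        have e2 := hN (v q) s
        have e3 := real_inner_self_eq_norm_sq (N s)
        have e4 := real_inner_comm (N (N s)) (N (v q))
        have e5 := real_inner_comm (v q) (N s)
        have e6 := real_inner_comm (N (N s)) s
        rw [← he, hs, map_add, norm_sub_sq_real, norm_add_sq_real, norm_sub_sq_real,
          norm_add_sq_real, inner_sub_right]
        linarith
  obtain ⟨s, -, he⟩ := key q
  have h3 : ‖N s‖ ^ 2 ≤ ‖s‖ ^ 2 := by
    have := hN1 s
    gcongr
  exact (sq_le_sq₀ (norm_nonneg _) (norm_nonneg _)).1 (by linarith)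

/-- Residual bound for the Chebyshev iteration, with a symmetric operator `R` whose spectrum
lies in `[1, b]`. The weights are `c q = (s ^ q + s⁻¹ ^ q) / 2`. -/
theorem norm_chebyshev_residual_le {E : Type*} [NormedAddCommGroup E] [InnerProductSpace ℝ E]
    (R : E →ₗ[ℝ] E) (hR : R.IsSymmetric) {b : ℝ} (hb : 1 < b)
    (hspec : ∀ x, 0 ≤ inner ℝ (R x - x) (b • x - R x))
    (u : ℕ → E) (d : E) {τ ρ : ℝ} (hτ : τ = 2 / (1 + b)) (hρ : ρ = (1 - 1 / b) / (1 + 1 / b))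
    (h1 : u 1 = u 0 - τ • R (u 0) + τ • d)
    (h2 : ∀ q, u (q + 2) = chebWeight ρ (q + 2) • (u (q + 1) - τ • R (u (q + 1))) +
      (1 - chebWeight ρ (q + 2)) • u q + (τ * chebWeight ρ (q + 2)) • d) (q : ℕ) :
    ‖R (u q) - d‖ ≤ 2 * Real.exp (-(2 * q * √(1 / b))) * ‖R (u 0) - d‖ := by
  have hb0 : 0 < b := by linarith
  have hρ' : ρ = (b - 1) / (b + 1) := by rw [hρ]; field_simp
  have hρ0 : 0 < ρ := by rw [hρ']; apply div_pos <;> linarith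
  set x := √(1 / b) with hx
  have hx2 : x ^ 2 = 1 / b := Real.sq_sqrt (by positivity)
  have hx0 : 0 < x := Real.sqrt_pos.2 (by positivity)
  have hx1 : x < 1 := by
    have : 1 / b < 1 := by rw [div_lt_one hb0]; exact hb
    nlinarith
  -- The larger root of s + s⁻¹ = 2/ρ, so that `c q` below is T_q(1/ρ).
  set s := (1 + x) / (1 - x) with hs
  have hx1' : 0 < 1 - x := by linarith
  have hs0 : 0 < s := by positivity
  have hbx : b = 1 / x ^ 2 := by rw [hx2]; field_simp
  have hss : s + s⁻¹ = 2 / ρ := by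
    rw [hρ', hbx, hs]
    have : 1 - x ^ 2 ≠ 0 := by nlinarith
    field_simp
    ring
  set c : ℕ → ℝ := fun q => (s ^ q + s⁻¹ ^ q) / 2 with hc
  have hcpos : ∀ q, 0 < c q := fun q => by positivity
  have hcrec : ∀ q, c (q + 2) = 2 / ρ * c (q + 1) - c q := by
    intro q
    simp only [hc, ← hss, pow_succ]
    field_simp
    ring
  have hc0 : c 0 = 1 := by simp [hc]
  have hc1 : c 1 = 1 / ρ := by
    simp only [hc, pow_one, hss]; field_simp
  have hα : ∀ q, chebWeight ρ (q + 1) = 2 * c q / (ρ * c (q + 1)) := by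
    intro q
    induction q with
    | zero => rw [hc0, hc1, chebWeight]; field_simp
    | succ q ih =>
      have h3 := (hcpos (q + 2)).ne'
      have h4 := (hcpos (q + 1)).ne'
      rw [chebWeight, ih]
      have h5 : 4 - ρ ^ 2 * (2 * c q / (ρ * c (q + 1))) = 2 * ρ * c (q + 2) / c (q + 1) := by
        rw [hcrec q]; field_simp; ring
      rw [h5]
      field_simp
      ring
  set N : E →ₗ[ℝ] E := ρ⁻¹ • (LinearMap.id - τ • R) with hNdef
  have hNapp : ∀ y, ρ • N y = y - τ • R y := fun y => by
    simp [hNdef, smul_smul, hρ0.ne']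
  have hNsymm : N.IsSymmetric := by
    intro y z
    simp [hNdef, inner_smul_left, inner_smul_right, inner_sub_left, inner_sub_right, hR y z]
  have hN1 : ∀ y, ‖N y‖ ≤ ‖y‖ := by
    intro y
    have h3 := hspec y
    have h4 : ‖ρ • N y‖ ^ 2 ≤ ρ ^ 2 * ‖y‖ ^ 2 := by
      rw [hNapp, norm_sub_sq_real, norm_smul, inner_smul_right, mul_pow, Real.norm_eq_abs, sq_abs]
      rw [inner_sub_left, inner_sub_right, inner_sub_right, inner_smul_right, inner_smul_right,
        real_inner_self_eq_norm_sq, real_inner_self_eq_norm_sq, real_inner_comm] at h3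
      have h5 : ‖y‖ ^ 2 - 2 * (τ * inner ℝ y (R y)) + τ ^ 2 * ‖R y‖ ^ 2 - ρ ^ 2 * ‖y‖ ^ 2 =
        -(4 / (1 + b) ^ 2) * (b * inner ℝ y (R y) - ‖R y‖ ^ 2 - (b * ‖y‖ ^ 2 - inner ℝ y (R y))) := by
        rw [hτ, hρ']
        field_simp
        ring
      have h6 : 0 ≤ 4 / (1 + b) ^ 2 := by positivity
      nlinarith [mul_nonneg h6 h3]
    rw [norm_smul, mul_pow, Real.norm_eq_abs, sq_abs] at h4
    exact (sq_le_sq₀ (norm_nonneg _) (norm_nonneg _)).1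
      (le_of_mul_le_mul_left h4 (by positivity))
  -- After rescaling by `c q`, the residuals satisfy the Chebyshev three-term recursion for the
  -- contraction N = (1 - τR)/ρ.
  have hmain : ‖c q • (R (u q) - d)‖ ≤ ‖c 0 • (R (u 0) - d)‖ := by
    refine norm_chebyshev_le N hNsymm hN1 (fun q => c q • (R (u q) - d)) ?_ (fun q => ?_) q
    · have h3 := hNapp (R (u 0) - d)
      simp only [hc0, hc1, one_smul, h1]
      have : N (R (u 0) - d) = ρ⁻¹ • ((R (u 0) - d) - τ • R (R (u 0) - d)) := by
        simp [hNdef]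
      rw [this, one_div]
      congr 1
      simp only [map_add, map_sub, map_smul]
      module
    · have h3 : N (c (q + 1) • (R (u (q + 1)) - d)) =
          (ρ⁻¹ * c (q + 1)) • ((R (u (q + 1)) - d) - τ • R (R (u (q + 1)) - d)) := by
        simp [hNdef, smul_smul, mul_comm]
      have h4 := hα (q + 1)
      have h5 : c (q + 2) * chebWeight ρ (q + 2) = 2 * (ρ⁻¹ * c (q + 1)) := by
        rw [h4]
        have := (hcpos (q + 2)).ne'
        field_simp
      have h6 : c q = 2 * (ρ⁻¹ * c (q + 1)) - c (q + 2) := by rw [hcrec]; field_simp; ring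
      have h7 : ρ⁻¹ * c (q + 1) = c (q + 2) * chebWeight ρ (q + 2) / 2 := by linarith
      simp only [h3, h6, h7, h2]
      generalize c (q + 2) = c'
      generalize chebWeight ρ (q + 2) = w
      simp only [map_add, map_sub, map_smul]
      module
  rw [hc0, one_smul, norm_smul, Real.norm_eq_abs, abs_of_pos (hcpos q)] at hmain
  -- First term of the series log((1 + x)/(1 - x)) = 2 ∑ x^(2k+1)/(2k+1).
  have hlog : 2 * x ≤ Real.log s := by
    have h3 := Real.hasSum_log_sub_log_of_abs_lt_one (x := x) (by rw [abs_of_pos hx0]; exact hx1)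
    rw [hs, Real.log_div (by positivity) hx1'.ne']
    have := le_hasSum h3 0 (fun k _ => by positivity)
    simpa using this
  have hsx : Real.exp (2 * q * x) ≤ 2 * c q := by
    have h3 : Real.exp (2 * q * x) ≤ s ^ q := by
      rw [← Real.exp_log hs0, ← Real.exp_nat_mul]
      apply Real.exp_le_exp.2
      nlinarith [(Nat.cast_nonneg q : (0 : ℝ) ≤ q)]
    have h4 : 0 < s⁻¹ ^ q := by positivity
    simp only [hc]
    linarith
  rw [Real.exp_neg]
  have h7 := Real.exp_pos (2 * q * x)
  have h8 : Real.exp (2 * q * x) * ‖R (u q) - d‖ ≤ 2 * ‖R (u 0) - d‖ := by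
    nlinarith [norm_nonneg (R (u q) - d)]
  rw [mul_assoc, mul_comm (_⁻¹), ← mul_assoc, ← div_eq_mul_inv, le_div_iff₀ h7]
  linarith

end Chebyshev

end XFilter

namespace XFilter

/-! ### The inexact proximal primal-dual method. -/

section ProximalPrimalDual

/-- A sequence that almost decreases, up to square-summable perturbations, and whose excess over
`c` has nonnegative partial sums: the decrements are summable with an explicit bound. -/
theorem sum_sq_le_of_almost_descent {l a b v : ℕ → ℝ} {c : ℝ}
    (h1 : ∀ n, l (n + 2) ≤ l (n + 1) - (1 - 1 / 96) * a (n + 2) ^ 2 + b (n + 2) * a (n + 2)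
      + v (n + 1))
    (h2 : ∀ n, v (n + 1) ≤ 1 / 12 * (b (n + 1) ^ 2 + b n ^ 2 + a (n + 1) ^ 2 + 103 / 100 * a n ^ 2))
    (h3 : ∀ n, b (n + 2) ^ 2 ≤
      1 / 1000 * (b (n + 1) ^ 2 + b n ^ 2 + a (n + 1) ^ 2 + a n ^ 2))
    (h4 : ∀ T, 0 ≤ ∑ n ∈ Finset.range T, (l (n + 1) - c)) (T : ℕ) :
    ∑ n ∈ Finset.range T, (1 / 2 * a (n + 2) ^ 2 + b (n + 2) ^ 2) ≤
      l 1 - c + (6 / 25 * a 1 ^ 2 + 1 / 10 * a 0 ^ 2 + 6 / 25 * b 1 ^ 2 + 1 / 10 * b 0 ^ 2) := by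
  -- The weight 1/10 pays for the index `n` terms of `h2` and `h3`, and 6/25 pays for the index `n +
  -- 1` terms together with the new 1/10. The decrease 1 - 1/96 exceeds 6/25 + 1/2 by almost 1/4,
  -- which is left for the cross term `b * a`.
  set p : ℕ → ℝ := fun n => l (n + 1) - c +
    (6 / 25 * a (n + 1) ^ 2 + 1 / 10 * a n ^ 2 + 6 / 25 * b (n + 1) ^ 2 + 1 / 10 * b n ^ 2) with hp
  have hdec : ∀ n, p (n + 1) + (1 / 2 * a (n + 2) ^ 2 + b (n + 2) ^ 2) ≤ p n := by
    intro n
    have e1 := h1 n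
    have e2 := h2 n
    have e3 := h3 n
    simp only [hp]
    nlinarith [sq_nonneg (b (n + 2) - 1 / 2 * a (n + 2)), sq_nonneg (a (n + 2)),
      sq_nonneg (a (n + 1)), sq_nonneg (a n), sq_nonneg (b (n + 1)), sq_nonneg (b n),
      sq_nonneg (b (n + 2))]
  have hanti : Antitone p := antitone_nat_of_succ_le fun n => by
    nlinarith [hdec n, sq_nonneg (a (n + 2)), sq_nonneg (b (n + 2))]
  have hpos : ∀ n, 0 ≤ p n := by
    intro n
    -- A negative value would persist by monotonicity, keep every later `l` below `c` by a fixed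
    -- amount, and drive the partial sums in `h4` to -∞.
    by_contra hneg
    push Not at hneg
    have hle : ∀ k, l (n + k + 1) - c ≤ p n := fun k => by
      have := hanti (Nat.le_add_right n k)
      simp only [hp] at this ⊢
      nlinarith [sq_nonneg (a (n + k + 1)), sq_nonneg (a (n + k)), sq_nonneg (b (n + k + 1)),
        sq_nonneg (b (n + k))]
    obtain ⟨k, hk⟩ := exists_nat_gt ((∑ i ∈ Finset.range n, (l (i + 1) - c)) / (-p n))
    rw [div_lt_iff₀ (by linarith)] at hk
    have h5 := h4 (n + k)
    rw [Finset.sum_range_add] at h5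
    have h6 : ∑ x ∈ Finset.range k, (l (n + x + 1) - c) ≤ k * p n := by
      refine (Finset.sum_le_sum fun i _ => hle i).trans ?_
      simp
    linarith
  have hsum : ∀ T, p T + ∑ n ∈ Finset.range T, (1 / 2 * a (n + 2) ^ 2 + b (n + 2) ^ 2) ≤ p 0 := by
    intro T
    induction T with
    | zero => simp
    | succ T ih => rw [Finset.sum_range_succ]; linarith [hdec T]
  have := hsum T
  have := hpos T
  simp only [hp] at *
  linarith

theorem norm_sum_four_sq_le {E : Type*} [NormedAddCommGroup E] {x : E} {p q r s : ℝ}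
    (h : ‖x‖ ≤ p + q + r + s) : ‖x‖ ^ 2 ≤ 4 * (p ^ 2 + q ^ 2 + r ^ 2 + s ^ 2) := by
  have h1 : ‖x‖ ^ 2 ≤ (p + q + r + s) ^ 2 := by gcongr
  nlinarith [sq_nonneg (p - q), sq_nonneg (p - r), sq_nonneg (p - s), sq_nonneg (q - r),
    sq_nonneg (q - s), sq_nonneg (r - s)]

variable {E F : Type*} [NormedAddCommGroup E] [InnerProductSpace ℝ E]
  [NormedAddCommGroup F] [InnerProductSpace ℝ F]

set_option maxHeartbeats 1000000 in
/-- The inexact proximal primal-dual method with unit step, for an objective `h` whose gradient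
`g` is `1/96`-Lipschitz and a constraint operator `A` with `(AᵀA)² ⪰ 48 AᵀA`. -/
theorem inexact_proximal_primal_dual (A : E →ₗ[ℝ] F) (A' : F →ₗ[ℝ] E)
    (hadj : ∀ x y, inner ℝ (A x) y = inner ℝ x (A' y))
    (hA : ∀ x, 48 * ‖A x‖ ^ 2 ≤ ‖A' (A x)‖ ^ 2)
    (h : E → ℝ) (g : E → E) {c : ℝ} (hc : ∀ x, c ≤ h x)
    (hdesc : ∀ x y, h y ≤ h x + inner ℝ (g x) (y - x) + 1 / 96 * ‖y - x‖ ^ 2)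
    (hg : ∀ x y, ‖g x - g y‖ ≤ 1 / 96 * ‖x - y‖)
    (z : ℕ → E) (μ : ℕ → F) (hz : z 0 = 0) (hμ0 : μ 0 = 0)
    (hμ : ∀ n, μ (n + 1) = μ n + A (z (n + 1))) {δ : ℝ} (hδ : δ ^ 2 ≤ 1 / 17000)
    (hstep : ∀ n, ‖g (z n) + A' (μ (n + 1)) + (z (n + 1) - z n)‖ ≤
      δ * ‖A' (A (z n)) + g (z n) + A' (μ n)‖) (T : ℕ) :
    ∑ r ∈ Finset.range T, ‖g (z (r + 2)) + A' (μ (r + 2))‖ ^ 2 ≤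
        21 / 5 * (h (z 1) - c + ‖g 0‖ ^ 2) ∧
      ∑ r ∈ Finset.range T, ‖A (z (r + 2))‖ ^ 2 ≤ h (z 1) - c + ‖g 0‖ ^ 2 := by
  -- the increments `w` and the residuals `η` of the filtering steps, with `w 0 = 0`
  set w : ℕ → E := fun n => z n - z (n - 1) with hw
  set η : ℕ → E := fun n => g (z (n - 1)) + A' (μ n) + w n with hη
  set γ : ℕ → E := fun n => g (z n) - g (z (n - 1)) with hγ
  have hγw : ∀ n, ‖γ n‖ ≤ 1 / 96 * ‖w n‖ := fun n => hg _ _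
  -- Truncated subtraction gives `z (0 - 1) = z 0`; hence `w 0` and `γ 0` vanish and the identities
  -- below also cover the first step.
  have hw0 : w 0 = 0 := by simp [hw]
  have hη0 : η 0 = g 0 := by simp [hη, hw0, hz, hμ0]
  -- The difference of two consecutive optimality conditions isolates the dual increment.
  have hAz : ∀ n, A' (A (z (n + 1))) = η (n + 1) - η n - (w (n + 1) - w n) - γ n := by
    intro n
    simp only [hη, hγ, Nat.add_sub_cancel, hμ, map_add]
    abel
  have hAzn : ∀ n, ‖A' (A (z (n + 1)))‖ ≤
      ‖η (n + 1)‖ + ‖η n‖ + ‖w (n + 1)‖ + (1 + 1 / 96) * ‖w n‖ := by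
    intro n
    rw [hAz]
    have e1 := norm_sub_le (η (n + 1) - η n - (w (n + 1) - w n)) (γ n)
    have e2 := norm_sub_le (η (n + 1) - η n) (w (n + 1) - w n)
    have e3 := norm_sub_le (η (n + 1)) (η n)
    have e4 := norm_sub_le (w (n + 1)) (w n)
    linarith [hγw n]
  -- The factor is 4/48: four squared terms, and the lower bound 48 in `hA`. The constant 103/100
  -- exceeds (1 + 1/96)².
  have hv : ∀ n, ‖A (z (n + 1))‖ ^ 2 ≤ 1 / 12 *
      (‖η (n + 1)‖ ^ 2 + ‖η n‖ ^ 2 + ‖w (n + 1)‖ ^ 2 + 103 / 100 * ‖w n‖ ^ 2) := by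
    intro n
    have e1 := norm_sum_four_sq_le (hAzn n)
    have e2 := hA (z (n + 1))
    nlinarith [sq_nonneg ‖w n‖]
  have hstep' : ∀ n, ‖η (n + 1)‖ ≤ δ * ‖A' (A (z n)) + g (z n) + A' (μ n)‖ := fun n => hstep n
  have hη1 : ‖η 1‖ ^ 2 ≤ 1 / 17000 * ‖g 0‖ ^ 2 := by
    have e1 := hstep' 0
    rw [hz, hμ0] at e1
    simp only [map_zero, zero_add, add_zero] at e1
    calc ‖η 1‖ ^ 2 ≤ (δ * ‖g 0‖) ^ 2 := by gcongr
      _ = δ ^ 2 * ‖g 0‖ ^ 2 := mul_pow _ _ _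
      _ ≤ _ := by gcongr
  -- The initial residual of an inner loop is again a combination of increments and earlier
  -- residuals. Its largest squared coefficient is 4(2 + 1/96)² < 17, and 17/17000 = 1/1000.
  have hηrec : ∀ n, ‖η (n + 2)‖ ^ 2 ≤
      1 / 1000 * (‖η (n + 1)‖ ^ 2 + ‖η n‖ ^ 2 + ‖w (n + 1)‖ ^ 2 + ‖w n‖ ^ 2) := by
    intro n
    have e1 : A' (A (z (n + 1))) + g (z (n + 1)) + A' (μ (n + 1)) =
        A' (A (z (n + 1))) + η (n + 1) - w (n + 1) + γ (n + 1) := by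
      simp only [hη, hγ]
      abel
    have e2 : ‖A' (A (z (n + 1))) + g (z (n + 1)) + A' (μ (n + 1))‖ ≤
        2 * ‖η (n + 1)‖ + ‖η n‖ + (2 + 1 / 96) * ‖w (n + 1)‖ + (1 + 1 / 96) * ‖w n‖ := by
      rw [e1]
      have f1 := norm_add_le (A' (A (z (n + 1))) + η (n + 1) - w (n + 1)) (γ (n + 1))
      have f2 := norm_sub_le (A' (A (z (n + 1))) + η (n + 1)) (w (n + 1))
      have f3 := norm_add_le (A' (A (z (n + 1)))) (η (n + 1))
      linarith [hγw (n + 1), hAzn n]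
    have e3 := norm_sum_four_sq_le e2
    have e4 := hstep' (n + 1)
    have e5 : ‖η (n + 2)‖ ^ 2 ≤
        δ ^ 2 * ‖A' (A (z (n + 1))) + g (z (n + 1)) + A' (μ (n + 1))‖ ^ 2 := by
      rw [← mul_pow]
      gcongr
    have e6 : δ ^ 2 * ‖A' (A (z (n + 1))) + g (z (n + 1)) + A' (μ (n + 1))‖ ^ 2 ≤
        1 / 17000 * (17 * (‖η (n + 1)‖ ^ 2 + ‖η n‖ ^ 2 + ‖w (n + 1)‖ ^ 2 + ‖w n‖ ^ 2)) := by
      refine mul_le_mul hδ (e3.trans ?_) (sq_nonneg _) (by norm_num)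
      nlinarith [sq_nonneg ‖w n‖, sq_nonneg ‖w (n + 1)‖, sq_nonneg ‖η n‖, sq_nonneg ‖η (n + 1)‖]
    linarith
  -- For n ≥ 1 this is the augmented Lagrangian h(z) + ⟨μ, Az⟩ + ‖Az‖²/2 at z = zₙ and μ = μₙ₋₁,
  -- with the square completed through μₙ = μₙ₋₁ + Azₙ.
  set l : ℕ → ℝ := fun n => h (z n) + 1 / 2 * ‖μ n‖ ^ 2 - 1 / 2 * ‖μ (n - 1)‖ ^ 2 with hl
  have hldesc : ∀ n, l (n + 2) ≤ l (n + 1) - (1 - 1 / 96) * ‖w (n + 2)‖ ^ 2 +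
      ‖η (n + 2)‖ * ‖w (n + 2)‖ + ‖A (z (n + 1))‖ ^ 2 := by
    intro n
    have e1 := hdesc (z (n + 1)) (z (n + 2))
    have e2 : g (z (n + 1)) = η (n + 2) - A' (μ (n + 2)) - w (n + 2) := by
      simp only [hη, show n + 2 - 1 = n + 1 from rfl]
      abel
    have e3 : z (n + 2) - z (n + 1) = w (n + 2) := rfl
    have e0 : inner ℝ (g (z (n + 1))) (w (n + 2)) = inner ℝ (w (n + 2)) (η (n + 2)) -
        inner ℝ (A (z (n + 2)) - A (z (n + 1))) (μ (n + 2)) - ‖w (n + 2)‖ ^ 2 := by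
      rw [← map_sub, hadj, e3, e2, real_inner_comm, inner_sub_right, inner_sub_right,
        real_inner_self_eq_norm_sq]
    have e0' : inner ℝ (A (z (n + 2)) - A (z (n + 1))) (μ (n + 2)) =
        inner ℝ (A (z (n + 2))) (μ (n + 1)) + ‖A (z (n + 2))‖ ^ 2 -
        (inner ℝ (A (z (n + 1))) (μ (n + 1)) + inner ℝ (A (z (n + 1))) (A (z (n + 2)))) := by
      rw [hμ (n + 1), inner_sub_left, inner_add_right, inner_add_right,
        real_inner_self_eq_norm_sq]
    rw [e3, e0, e0'] at e1
    have e4 := real_inner_le_norm (w (n + 2)) (η (n + 2))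
    have e5 : ‖μ n‖ ^ 2 = ‖μ (n + 1)‖ ^ 2 - 2 * inner ℝ (μ (n + 1)) (A (z (n + 1))) +
        ‖A (z (n + 1))‖ ^ 2 := by
      rw [← norm_sub_sq_real, hμ n, add_sub_cancel_right]
    have e6 : ‖μ (n + 2)‖ ^ 2 = ‖μ (n + 1)‖ ^ 2 + 2 * inner ℝ (μ (n + 1)) (A (z (n + 2))) +
        ‖A (z (n + 2))‖ ^ 2 := by
      rw [← norm_add_sq_real, ← hμ]
    have e7 : 0 ≤ ‖A (z (n + 2)) - A (z (n + 1))‖ ^ 2 := by positivity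
    rw [norm_sub_sq_real] at e7
    have e8 := real_inner_comm (μ (n + 1)) (A (z (n + 1)))
    have e9 := real_inner_comm (μ (n + 1)) (A (z (n + 2)))
    have e10 := real_inner_comm (A (z (n + 1))) (A (z (n + 2)))
    simp only [hl, Nat.add_sub_cancel, show n + 2 - 1 = n + 1 from rfl]
    linarith
  -- The dual terms telescope to ‖μ_T‖²/2, so no bound on the multipliers is needed.
  have hlsum : ∀ T, 0 ≤ ∑ n ∈ Finset.range T, (l (n + 1) - c) := by
    intro T
    have e1 : ∀ T, 1 / 2 * ‖μ T‖ ^ 2 ≤ ∑ n ∈ Finset.range T, (l (n + 1) - c) := by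
      intro T
      induction T with
      | zero => simp [hμ0]
      | succ T ih =>
        rw [Finset.sum_range_succ]
        have := hc (z (T + 1))
        simp only [hl, Nat.add_sub_cancel] at *
        linarith
    exact le_trans (by positivity) (e1 T)
  have hmain := sum_sq_le_of_almost_descent (a := fun n => ‖w n‖) (b := fun n => ‖η n‖)
    (v := fun n => ‖A (z n)‖ ^ 2)
    hldesc hv hηrec hlsum
  -- the first step
  have hfirst : w 1 + A' (A (w 1)) = η 1 - g 0 := by
    simp only [hη, hw, hμ, hμ0, hz, Nat.sub_self, sub_zero, zero_add]
    abel
  have hw1 : ‖w 1‖ ^ 2 + ‖A (z 1)‖ ^ 2 ≤ ‖η 1 - g 0‖ ^ 2 := by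
    have e1 : w 1 = z 1 := by simp [hw, hz]
    rw [← hfirst, norm_add_sq_real, ← hadj, real_inner_self_eq_norm_sq, e1]
    nlinarith [sq_nonneg ‖A (z 1)‖, sq_nonneg ‖A' (A (z 1))‖]
  have hμ1 : ‖A (z 1)‖ ^ 2 ≤ 1 / 48 * ‖η 1 - g 0‖ ^ 2 := by
    have e1 : w 1 = z 1 := by simp [hw, hz]
    have e2 := hA (z 1)
    have e3 : ‖A' (A (z 1))‖ ^ 2 ≤ ‖η 1 - g 0‖ ^ 2 := by
      rw [← hfirst, norm_add_sq_real, ← hadj, real_inner_self_eq_norm_sq, e1]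
      nlinarith [sq_nonneg ‖A (z 1)‖, sq_nonneg ‖z 1‖]
    linarith
  have hηg : ‖η 1 - g 0‖ ^ 2 ≤ 11 / 10 * ‖g 0‖ ^ 2 := by
    have e1 := norm_sub_le (η 1) (g 0)
    have e2 : ‖η 1 - g 0‖ ^ 2 ≤ (‖η 1‖ + ‖g 0‖) ^ 2 := by gcongr
    nlinarith [sq_nonneg (20 * ‖η 1‖ - ‖g 0‖), sq_nonneg ‖g 0‖]
  have hl1 : l 1 = h (z 1) + 1 / 2 * ‖A (z 1)‖ ^ 2 := by
    simp [hl, hμ, hμ0]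
  have hbound : ∀ T, ∑ n ∈ Finset.range T, (1 / 2 * ‖w (n + 2)‖ ^ 2 + ‖η (n + 2)‖ ^ 2) ≤
      h (z 1) - c + 1 / 2 * ‖g 0‖ ^ 2 := by
    intro T
    have e1 := hmain T
    simp only [hl1, hw0, hη0, norm_zero] at e1
    nlinarith [sq_nonneg ‖g 0‖, sq_nonneg ‖A (z 1)‖]
  have hcz := hc (z 1)
  constructor
  · have e1 : ∀ r, ‖g (z (r + 2)) + A' (μ (r + 2))‖ ^ 2 ≤
        21 / 5 * (1 / 2 * ‖w (r + 2)‖ ^ 2 + ‖η (r + 2)‖ ^ 2) := by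
      intro r
      have f1 : g (z (r + 2)) + A' (μ (r + 2)) = η (r + 2) - w (r + 2) + γ (r + 2) := by
        simp only [hη, hγ]
        abel
      have f2 : ‖g (z (r + 2)) + A' (μ (r + 2))‖ ≤ ‖η (r + 2)‖ + (1 + 1 / 96) * ‖w (r + 2)‖ := by
        rw [f1]
        have := norm_add_le (η (r + 2) - w (r + 2)) (γ (r + 2))
        have := norm_sub_le (η (r + 2)) (w (r + 2))
        linarith [hγw (r + 2)]
      have f3 : ‖g (z (r + 2)) + A' (μ (r + 2))‖ ^ 2 ≤
          (‖η (r + 2)‖ + (1 + 1 / 96) * ‖w (r + 2)‖) ^ 2 := by gcongr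
      nlinarith [sq_nonneg (‖η (r + 2)‖ - ‖w (r + 2)‖), sq_nonneg ‖w (r + 2)‖,
        sq_nonneg ‖η (r + 2)‖]
    refine (Finset.sum_le_sum fun r _ => e1 r).trans ?_
    rw [← Finset.mul_sum]
    have := hbound T
    nlinarith [sq_nonneg ‖g 0‖]
  · -- both sums of consecutive terms are bounded by the total
    set k : ℕ → ℝ := fun n => 1 / 2 * ‖w n‖ ^ 2 + ‖η n‖ ^ 2 with hk
    have hk0 : ∀ n, 0 ≤ k n := fun n => by positivity
    have e1 : ∀ r, ‖A (z (r + 2))‖ ^ 2 ≤ 1 / 5 * (k (r + 2) + k (r + 1)) := by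
      intro r
      have := hv (r + 1)
      simp only [hk]
      nlinarith [sq_nonneg ‖w (r + 2)‖, sq_nonneg ‖w (r + 1)‖, sq_nonneg ‖η (r + 2)‖,
        sq_nonneg ‖η (r + 1)‖]
    refine (Finset.sum_le_sum fun r _ => e1 r).trans ?_
    rw [← Finset.mul_sum, Finset.sum_add_distrib]
    have e2 : ∑ r ∈ Finset.range T, k (r + 1) ≤ k 1 + ∑ r ∈ Finset.range T, k (r + 2) := by
      have f1 := Finset.sum_range_succ' (fun r => k (r + 1)) T
      have f2 := Finset.sum_range_succ (fun r => k (r + 1)) T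
      have := hk0 (T + 1)
      simp only [zero_add] at f1
      linarith
    have e3 := hbound T
    have e4 : k 1 ≤ 3 / 5 * ‖g 0‖ ^ 2 := by
      simp only [hk]
      nlinarith [sq_nonneg ‖g 0‖, sq_nonneg ‖A (z 1)‖]
    nlinarith [sq_nonneg ‖g 0‖]

end ProximalPrimalDual

end XFilter

namespace XFilter

/-! ### Matrices acting on vectors of blocks. -/

section BlockMap

variable {l m n : Type*} [Fintype l] [Fintype m] [Fintype n] {S : ℕ}

/-- Vectors of blocks with their Euclidean norm. -/
abbrev Blocks (m : Type*) (S : ℕ) := PiLp 2 (fun _ : m => Vec S)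

/-- The blockwise action of a matrix, as a linear map of Euclidean spaces. -/
def blockMap (A : Matrix m n ℝ) : Blocks n S →ₗ[ℝ] Blocks m S where
  toFun x := WithLp.toLp 2 (act A x.ofLp)
  map_add' x y := by
    ext i : 1
    simp [act, Finset.sum_add_distrib]
  map_smul' c x := by
    ext i : 1
    simp [act, Finset.smul_sum, smul_smul, mul_comm]

omit [Fintype m] in
theorem blockMap_apply (A : Matrix m n ℝ) (x : Blocks n S) (i : m) :
    blockMap A x i = ∑ j, A i j • x j := rfl

omit [Fintype m] in
theorem toLp_act (A : Matrix m n ℝ) (x : n → Vec S) :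
    WithLp.toLp 2 (act A x) = blockMap A (WithLp.toLp 2 x) := rfl

omit [Fintype l] in
theorem blockMap_mul (A : Matrix l m ℝ) (B : Matrix m n ℝ) (x : Blocks n S) :
    blockMap (A * B) x = blockMap A (blockMap B x) := by
  ext i : 1
  simp only [blockMap_apply, Matrix.mul_apply, Finset.sum_smul, Finset.smul_sum, smul_smul]
  exact Finset.sum_comm

theorem blockMap_diagonal [DecidableEq n] (a : n → ℝ) (x : Blocks n S) (i : n) :
    blockMap (diagonal a) x i = a i • x i := by
  rw [blockMap_apply, Finset.sum_eq_single i]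
  · simp
  · intro j _ hj
    simp [diagonal_apply_ne' _ hj]
  · simp

theorem blockMap_one [DecidableEq n] (x : Blocks n S) :
    blockMap (1 : Matrix n n ℝ) x = x := by
  ext i : 1
  rw [← diagonal_one, blockMap_diagonal]
  simp

omit [Fintype m] in
theorem blockMap_add (A B : Matrix m n ℝ) (x : Blocks n S) :
    blockMap (A + B) x = blockMap A x + blockMap B x := by
  ext i : 1
  simp [blockMap_apply, add_smul, Finset.sum_add_distrib]

omit [Fintype m] in
theorem blockMap_sub (A B : Matrix m n ℝ) (x : Blocks n S) :
    blockMap (A - B) x = blockMap A x - blockMap B x := by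
  ext i : 1
  simp [blockMap_apply, sub_smul, Finset.sum_sub_distrib]

omit [Fintype m] in
theorem blockMap_smul (c : ℝ) (A : Matrix m n ℝ) (x : Blocks n S) :
    blockMap (c • A) x = c • blockMap A x := by
  ext i : 1
  simp [blockMap_apply, Finset.smul_sum, smul_smul]

theorem inner_blockMap_left (A : Matrix m n ℝ) (x : Blocks n S) (y : Blocks m S) :
    inner ℝ (blockMap A x) y = inner ℝ x (blockMap Aᵀ y) := by
  simp only [PiLp.inner_apply, blockMap_apply, sum_inner, inner_sum, inner_smul_left,
    inner_smul_right, Matrix.transpose_apply, conj_trivial]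
  exact Finset.sum_comm

theorem inner_blockMap_nonneg {A : Matrix n n ℝ} (hA : A.PosSemidef) (x : Blocks n S) :
    0 ≤ inner ℝ x (blockMap A x) := by
  have : inner ℝ x (blockMap A x) = ∑ s, (fun i => x i s) ⬝ᵥ A *ᵥ (fun i => x i s) := by
    simp only [PiLp.inner_apply, blockMap_apply, dotProduct, mulVec]
    rw [Finset.sum_comm]
    refine Finset.sum_congr rfl fun i _ => Finset.sum_congr rfl fun s _ => ?_
    simp [mul_comm]
  rw [this]
  exact Finset.sum_nonneg fun s _ => by simpa using hA.dotProduct_mulVec_nonneg (fun i => x i s)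

theorem sqNorm_eq (x : m → Vec S) : sqNorm x = ‖(WithLp.toLp 2 x : Blocks m S)‖ ^ 2 := by
  rw [PiLp.norm_sq_eq_of_L2]
  rfl

end BlockMap

/-! ### Smoothness of the objective in the normalized variables. -/

section Smooth

/-- Descent inequality for a function with Lipschitz gradient. -/
theorem le_of_lipschitz_gradient {E : Type*} [NormedAddCommGroup E] [InnerProductSpace ℝ E]
    [CompleteSpace E] {f : E → ℝ} (hf : Differentiable ℝ f) {K : ℝ} (hK : 0 ≤ K)
    (hlip : ∀ x z, ‖gradient f x - gradient f z‖ ≤ K * ‖x - z‖) (x y : E) :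
    f y ≤ f x + inner ℝ (gradient f x) (y - x) + K * ‖y - x‖ ^ 2 := by
  have hd : ∀ t : ℝ, HasDerivAt (fun t : ℝ => f (x + t • (y - x)))
      (inner ℝ (gradient f (x + t • (y - x))) (y - x)) t := by
    intro t
    have h1 : HasDerivAt (fun t : ℝ => x + t • (y - x)) (y - x) t := by
      simpa using ((hasDerivAt_id t).smul_const (y - x)).const_add x
    have h2 := (hf (x + t • (y - x))).hasGradientAt.hasFDerivAt.comp_hasDerivAt t h1
    exact HasDerivAt.congr_deriv h2 (by simp)
  -- A single mean value point gives the constant `K` instead of `K / 2`, which is enough for the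
  -- outer analysis.
  obtain ⟨t, ht, he⟩ := exists_hasDerivAt_eq_slope (fun t : ℝ => f (x + t • (y - x))) _ one_pos
    (fun t _ => (hd t).continuousAt.continuousWithinAt) (fun t _ => hd t)
  simp only [one_smul, zero_smul, add_zero, sub_zero, div_one, add_sub_cancel] at he
  have h1 := hlip (x + t • (y - x)) x
  rw [add_sub_cancel_left, norm_smul, Real.norm_eq_abs, abs_of_pos ht.1] at h1
  have h2 := real_inner_le_norm (gradient f (x + t • (y - x)) - gradient f x) (y - x)
  rw [inner_sub_left] at h2
  have h3 : ‖gradient f (x + t • (y - x)) - gradient f x‖ ≤ K * ‖y - x‖ := by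
    refine h1.trans (mul_le_mul_of_nonneg_left ?_ hK)
    nlinarith [norm_nonneg (y - x), ht.2]
  nlinarith [norm_nonneg (y - x), mul_le_mul_of_nonneg_right h3 (norm_nonneg (y - x))]

/-- The left side is the Lipschitz constant of one block of the gradient after the substitution zᵢ =
βᵢxᵢ, which contributes one factor 1/βᵢ from the argument and one from the chain rule. -/
theorem lipschitz_scaled_le {N l b : ℝ} (hN : 0 < N) (hb : 0 < b) (h : 96 / N * l ≤ b ^ 2) :
    1 / N * (l * (1 / b) ^ 2) ≤ 1 / 96 := by
  rw [div_mul_eq_mul_div, div_le_iff₀ hN] at h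
  rw [_root_.one_div_pow, mul_one_div, div_mul_div_comm, one_mul,
    div_le_div_iff₀ (by positivity) (by norm_num)]
  linarith

variable {M S : ℕ} (f : Fin M → Vec S → ℝ) (β : Fin M → ℝ)

/-- The objective in the normalized variables `zᵢ = βᵢ xᵢ`. -/
noncomputable def normObjective (z : Blocks (Fin M) S) : ℝ := objective f fun i => (1 / β i) • z i

/-- The gradient of the objective in the normalized variables. -/
noncomputable def normGradient (z : Blocks (Fin M) S) : Blocks (Fin M) S :=
  WithLp.toLp 2 fun i => (1 / β i) • gradObjective f (fun i => (1 / β i) • z i) i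

variable {f β} {L : Fin M → ℝ}

theorem normObjective_le (hf : ProblemClass f L) (hβ : ∀ i, 0 < β i)
    (hB : ∀ i, 96 / M * L i ≤ β i ^ 2) (x y : Blocks (Fin M) S) :
    normObjective f β y ≤ normObjective f β x + inner ℝ (normGradient f β x) (y - x) +
      1 / 96 * ‖y - x‖ ^ 2 := by
  rw [PiLp.norm_sq_eq_of_L2, PiLp.inner_apply]
  simp only [normObjective, objective, normGradient, gradObjective, Finset.mul_sum]
  rw [← Finset.sum_add_distrib, ← Finset.sum_add_distrib]
  refine Finset.sum_le_sum fun i _ => ?_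
  have hM : (0 : ℝ) < M := by exact_mod_cast i.pos
  have h1 := le_of_lipschitz_gradient (hf.differentiable i) (hf.lip_pos i).le (hf.lip_gradient i)
    ((1 / β i) • x i) ((1 / β i) • y i)
  rw [← smul_sub, inner_smul_right, norm_smul, mul_pow, Real.norm_eq_abs, sq_abs] at h1
  have h2 := lipschitz_scaled_le hM (hβ i) (hB i)
  simp only [inner_smul_left, conj_trivial, PiLp.sub_apply]
  have h3 := mul_le_mul_of_nonneg_left h1 (show 0 ≤ 1 / (M : ℝ) by positivity)
  have h4 := mul_le_mul_of_nonneg_right h2 (sq_nonneg ‖y i - x i‖)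
  linarith

theorem norm_normGradient_sub_le (hf : ProblemClass f L) (hβ : ∀ i, 0 < β i)
    (hB : ∀ i, 96 / M * L i ≤ β i ^ 2) (x y : Blocks (Fin M) S) :
    ‖normGradient f β x - normGradient f β y‖ ≤ 1 / 96 * ‖x - y‖ := by
  refine (sq_le_sq₀ (norm_nonneg _) (by positivity)).1 ?_
  rw [mul_pow, PiLp.norm_sq_eq_of_L2, PiLp.norm_sq_eq_of_L2, Finset.mul_sum]
  refine Finset.sum_le_sum fun i _ => ?_
  have hM : (0 : ℝ) < M := by exact_mod_cast i.pos
  have hb := hβ i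
  rw [← mul_pow]
  refine (sq_le_sq₀ (norm_nonneg _) (by positivity)).2 ?_
  simp only [normGradient, gradObjective, PiLp.sub_apply]
  rw [← smul_sub, ← smul_sub, norm_smul, norm_smul, Real.norm_eq_abs, Real.norm_eq_abs,
    abs_of_pos (by positivity), abs_of_pos (by positivity)]
  have h1 := hf.lip_gradient i ((1 / β i) • x i) ((1 / β i) • y i)
  rw [← smul_sub, norm_smul, Real.norm_eq_abs, abs_of_pos (by positivity)] at h1
  have h2 := lipschitz_scaled_le hM hb (hB i)
  calc _ ≤ 1 / β i * (1 / M * (L i * (1 / β i * ‖x i - y i‖))) := by gcongr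
    _ = 1 / (M : ℝ) * (L i * (1 / β i) ^ 2) * ‖x i - y i‖ := by ring
    _ ≤ _ := by gcongr

theorem norm_normGradient_zero_sq_le (hf : ProblemClass f L) (hβ : ∀ i, 0 < β i)
    (hB : ∀ i, 96 / M * L i ≤ β i ^ 2) :
    ‖normGradient f β 0‖ ^ 2 ≤ 5 / (M : ℝ) * ∑ i, ‖gradient (f i) 0‖ ^ 2 / L i := by
  rw [PiLp.norm_sq_eq_of_L2, Finset.mul_sum]
  refine Finset.sum_le_sum fun i _ => ?_
  have hM : (0 : ℝ) < M := by exact_mod_cast i.pos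
  have hb := hβ i
  have hL := hf.lip_pos i
  simp only [normGradient, gradObjective, PiLp.zero_apply, smul_zero]
  rw [norm_smul, norm_smul, mul_pow, mul_pow, Real.norm_eq_abs, Real.norm_eq_abs, sq_abs, sq_abs,
    ← mul_assoc, mul_div_assoc', mul_comm (5 / (M : ℝ)), mul_div_assoc, mul_comm]
  gcongr
  have := hB i
  rw [div_mul_eq_mul_div, div_le_iff₀ hM] at this
  rw [_root_.one_div_pow, _root_.one_div_pow, div_mul_div_comm, div_div, div_le_div_iff₀ (by positivity)
    (by positivity)]
  nlinarith [mul_pos hM hL]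

end Smooth

end XFilter

namespace XFilter

/-! ### The normalized incidence matrix and Laplacian. -/

section NormalizedMatrices

variable {M : ℕ} (G : SimpleGraph (Fin M)) [DecidableRel G.Adj]
  (σ : G.edgeSet → ℝ) (β : Fin M → ℝ)

theorem inf_lt_sup_of_edge (e : G.edgeSet) :
    (e : Sym2 (Fin M)).inf < (e : Sym2 (Fin M)).sup ∧
      0 < G.degree (e : Sym2 (Fin M)).inf ∧ 0 < G.degree (e : Sym2 (Fin M)).sup := by
  obtain ⟨e, he⟩ := e
  induction e with
  | _ a b =>
    have hab : G.Adj a b := he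
    have ha := (G.degree_pos_iff_exists_adj a).2 ⟨b, hab⟩
    have hb := (G.degree_pos_iff_exists_adj b).2 ⟨a, hab.symm⟩
    rcases lt_or_gt_of_ne hab.ne with h | h
    · rw [show s(a, b).inf = a from inf_eq_left.2 h.le, show s(a, b).sup = b from sup_eq_right.2 h.le]
      exact ⟨h, ha, hb⟩
    · rw [show s(a, b).inf = b from inf_eq_right.2 h.le, show s(a, b).sup = a from sup_eq_left.2 h.le]
      exact ⟨h, hb, ha⟩

theorem scaledIncidence_apply (e : G.edgeSet) (v : Fin M) :
    scaledIncidence G e v = if v = (e : Sym2 (Fin M)).sup then 1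
      else if v = (e : Sym2 (Fin M)).inf then -1 else 0 := by
  obtain ⟨-, h1, h2⟩ := inf_lt_sup_of_edge G e
  have h1' : √(G.degree (e : Sym2 (Fin M)).inf : ℝ) ≠ 0 := (Real.sqrt_pos.2 (by exact_mod_cast h1)).ne'
  have h2' : √(G.degree (e : Sym2 (Fin M)).sup : ℝ) ≠ 0 := (Real.sqrt_pos.2 (by exact_mod_cast h2)).ne'
  rw [scaledIncidence, degSqrt, mul_diagonal, incidence]
  split_ifs with h3 h4
  · subst h3; field_simp
  · subst h4; field_simp
  · simp

theorem scaledIncidence_mulVec_one : scaledIncidence G *ᵥ 1 = 0 := by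
  ext e
  have h := (inf_lt_sup_of_edge G e).1
  simp only [mulVec, dotProduct, scaledIncidence_apply, Pi.one_apply, mul_one, Pi.zero_apply]
  have h1 : ∀ v : Fin M, (if v = (e : Sym2 (Fin M)).sup then (1 : ℝ)
      else if v = (e : Sym2 (Fin M)).inf then -1 else 0) =
      (if v = (e : Sym2 (Fin M)).sup then 1 else 0) -
        (if v = (e : Sym2 (Fin M)).inf then 1 else 0) := by
    intro v
    split_ifs with h3 h4 h4
    · exact absurd (h4.symm.trans h3) h.ne
    all_goals simp
  rw [Finset.sum_congr rfl fun v _ => h1 v, Finset.sum_sub_distrib]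
  simp

/-- The incidence matrix `Σ F Υ⁻¹` in the normalized variables. -/
noncomputable def normIncidence : Matrix G.edgeSet (Fin M) ℝ :=
  diagonal σ * scaledIncidence G * diagonal fun i => 1 / β i

/-- The Laplacian `Υ⁻¹ Fᵀ Σ² F Υ⁻¹` in the normalized variables. -/
noncomputable def normLaplacian : Matrix (Fin M) (Fin M) ℝ :=
  (normIncidence G σ β)ᵀ * normIncidence G σ β

theorem posSemidef_normLaplacian : (normLaplacian G σ β).PosSemidef := by
  have := posSemidef_conjTranspose_mul_self (normIncidence G σ β)
  rwa [conjTranspose_eq_transpose_of_trivial] at this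

theorem normLaplacian_eq : normLaplacian G σ β =
    (diagonal fun i => 1 / β i) * (scaledIncidence G)ᵀ * sigmaSq σ * scaledIncidence G *
      diagonal fun i => 1 / β i := by
  have : sigmaSq σ = diagonal σ * diagonal σ := by
    rw [diagonal_mul_diagonal]; simp only [sigmaSq, sq]
  rw [normLaplacian, normIncidence, this]
  simp only [transpose_mul, diagonal_transpose, Matrix.mul_assoc]

variable {β} (hβ : ∀ i, 0 < β i)
include hβ

theorem diagonal_mul_diagonal_inv : diagonal β * (diagonal fun i => 1 / β i) = 1 := by
  rw [diagonal_mul_diagonal, ← diagonal_one]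
  congr 1
  ext i
  exact mul_one_div_cancel (hβ i).ne'

theorem diagonal_inv_mul_diagonal : (diagonal fun i => 1 / β i) * diagonal β = 1 := by
  rw [diagonal_mul_diagonal, ← diagonal_one]
  congr 1
  ext i
  exact one_div_mul_cancel (hβ i).ne'

theorem normIncidence_mul_diagonal :
    normIncidence G σ β * diagonal β = diagonal σ * scaledIncidence G := by
  rw [normIncidence, Matrix.mul_assoc, diagonal_inv_mul_diagonal hβ, Matrix.mul_one]

/-- Consensus vectors lie in ker F, and Υ maps the all-ones vector to β. -/
theorem normIncidence_mulVec_self : normIncidence G σ β *ᵥ β = 0 := by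
  have h : diagonal β *ᵥ (1 : Fin M → ℝ) = β := by ext i; simp [mulVec_diagonal]
  have h2 := congrArg (· *ᵥ (1 : Fin M → ℝ)) (normIncidence_mul_diagonal G σ hβ)
  simp only [← Matrix.mulVec_mulVec, h, scaledIncidence_mulVec_one, mulVec_zero] at h2
  exact h2

theorem diagonal_mul_laplacian :
    diagonal β * (upsilonInvSq β * (scaledIncidence G)ᵀ * sigmaSq σ * scaledIncidence G) =
      normLaplacian G σ β * diagonal β := by
  have h : diagonal β * upsilonInvSq β = diagonal fun i => 1 / β i := by
    rw [upsilonInvSq, diagonal_mul_diagonal]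
    congr 1
    ext i
    have := (hβ i).ne'
    field_simp
  rw [normLaplacian_eq]
  simp only [← Matrix.mul_assoc, h]
  rw [Matrix.mul_assoc _ (diagonal _) (diagonal β), diagonal_inv_mul_diagonal hβ, Matrix.mul_one]

/-- R itself need not be symmetric; conjugation by Υ makes it so, and both the Chebyshev bound and
the eigenvalue estimates use this form. -/
theorem diagonal_mul_filterMatrix :
    diagonal β * filterMatrix G σ β = (normLaplacian G σ β + 1) * diagonal β := by
  rw [filterMatrix, Matrix.mul_add, diagonal_mul_laplacian G σ hβ, Matrix.add_mul]
  simp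

theorem upsilonSq_mul_filterMatrix :
    upsilonSq β * filterMatrix G σ β =
      diagonal β * (normLaplacian G σ β + 1) * diagonal β := by
  have : upsilonSq β = diagonal β * diagonal β := by
    rw [diagonal_mul_diagonal]; simp only [upsilonSq, sq]
  rw [this, Matrix.mul_assoc, diagonal_mul_filterMatrix G σ hβ, Matrix.mul_assoc]

theorem spectrum_filterMatrix :
    spectrum ℝ (filterMatrix G σ β) = spectrum ℝ (normLaplacian G σ β + 1) := by
  have h : filterMatrix G σ β =
      (diagonal fun i => 1 / β i) * (normLaplacian G σ β + 1) * diagonal β := by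
    rw [Matrix.mul_assoc, ← diagonal_mul_filterMatrix G σ hβ, ← Matrix.mul_assoc,
      diagonal_inv_mul_diagonal hβ, Matrix.one_mul]
  let u : (Matrix (Fin M) (Fin M) ℝ)ˣ := ⟨diagonal fun i => 1 / β i, diagonal β,
    diagonal_inv_mul_diagonal hβ, diagonal_mul_diagonal_inv hβ⟩
  rw [h]
  exact spectrum.units_conjugate (u := u)

-- The matrix in κ̃ is XXᵀ, which has the same nonzero eigenvalues as XᵀX.
omit hβ in
theorem kappaTilde_eq :
    kappaTilde G σ β = 1 / eigMinNonzero (normLaplacian G σ β) := by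
  have h : upsilonInvSq β = (diagonal fun i => 1 / β i) * diagonal fun i => 1 / β i := by
    rw [diagonal_mul_diagonal, upsilonInvSq]
    congr 1
    ext i
    rw [div_mul_div_comm, one_mul, sq]
  have h2 : diagonal σ * scaledIncidence G * upsilonInvSq β * (scaledIncidence G)ᵀ * diagonal σ =
      normIncidence G σ β * (normIncidence G σ β)ᵀ := by
    rw [h, normIncidence]
    simp only [transpose_mul, diagonal_transpose, Matrix.mul_assoc]
  rw [kappaTilde, normLaplacian, h2, eigMinNonzero_mul_comm]

end NormalizedMatrices

/-! ### Eigenvalues of R, Υ² and Υ²R. -/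

section Eigenvalues

variable {M : ℕ} {G : SimpleGraph (Fin M)} [DecidableRel G.Adj]
  {σ : G.edgeSet → ℝ} {β : Fin M → ℝ}

theorem isHermitian_normLaplacian_add_one : (normLaplacian G σ β + 1).IsHermitian :=
  (posSemidef_normLaplacian G σ β).1.add isHermitian_one

theorem add_one_mem_spectrum {t : ℝ} (ht : t ∈ spectrum ℝ (normLaplacian G σ β)) :
    t + 1 ∈ spectrum ℝ (normLaplacian G σ β + 1) := by
  obtain ⟨v, hv, e⟩ := exists_eigenvector ht
  exact mem_spectrum_of_eigenvector hv (by rw [add_mulVec, e, one_mulVec, add_smul, one_smul])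

theorem quadForm_upsilonSq (v : Fin M → ℝ) :
    v ⬝ᵥ upsilonSq β *ᵥ v = (diagonal β *ᵥ v) ⬝ᵥ (diagonal β *ᵥ v) := by
  simp only [upsilonSq, dotProduct, mulVec_diagonal]
  exact Finset.sum_congr rfl fun i _ => by ring

theorem isHermitian_upsilonSq : (upsilonSq β).IsHermitian := by
  simp [upsilonSq]

variable (hβ : ∀ i, 0 < β i)

include hβ in
theorem quadForm_upsilonSq_mul_filterMatrix (v : Fin M → ℝ) :
    v ⬝ᵥ (upsilonSq β * filterMatrix G σ β) *ᵥ v =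
      (diagonal β *ᵥ v) ⬝ᵥ (normLaplacian G σ β + 1) *ᵥ (diagonal β *ᵥ v) := by
  rw [upsilonSq_mul_filterMatrix G σ hβ, Matrix.mul_assoc, ← Matrix.mulVec_mulVec,
    dotProduct_mulVec, ← mulVec_transpose, diagonal_transpose, Matrix.mulVec_mulVec]

include hβ in
theorem isHermitian_upsilonSq_mul_filterMatrix :
    (upsilonSq β * filterMatrix G σ β).IsHermitian := by
  rw [upsilonSq_mul_filterMatrix G σ hβ]
  have := isHermitian_conjTranspose_mul_mul (diagonal β)
    (isHermitian_normLaplacian_add_one (G := G) (σ := σ) (β := β))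
  simpa using this

variable [Nonempty (Fin M)]

-- The value 1 is attained because β is in the kernel of the normalized Laplacian. Hence ξ(R) =
-- 1/λ_max(R).
include hβ in
theorem eigMin_filterMatrix : eigMin (filterMatrix G σ β) = 1 := by
  have h0 : eigMin (filterMatrix G σ β) = eigMin (normLaplacian G σ β + 1) := by
    rw [eigMin, spectrum_filterMatrix G σ hβ, eigMin]
  rw [h0]
  apply le_antisymm
  · have h1 : (0 : ℝ) ∈ spectrum ℝ (normLaplacian G σ β) := by
      have i : Fin M := Classical.arbitrary _
      refine mem_spectrum_of_eigenvector (v := β) (fun h => (hβ i).ne' (congrFun h i)) ?_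
      rw [normLaplacian, ← Matrix.mulVec_mulVec, normIncidence_mulVec_self G σ hβ, mulVec_zero,
        zero_smul]
    simpa using eigMin_le (add_one_mem_spectrum h1)
  · refine le_eigMin isHermitian_normLaplacian_add_one fun v => ?_
    have := PosSemidef.quadForm_nonneg (posSemidef_normLaplacian G σ β) v
    rw [add_mulVec, one_mulVec, dotProduct_add]
    linarith

include hβ in
theorem eigMax_filterMatrix :
    eigMax (filterMatrix G σ β) = eigMax (normLaplacian G σ β) + 1 := by
  have h0 : eigMax (filterMatrix G σ β) = eigMax (normLaplacian G σ β + 1) := by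
    rw [eigMax, spectrum_filterMatrix G σ hβ, eigMax]
  rw [h0]
  apply le_antisymm
  · refine eigMax_le isHermitian_normLaplacian_add_one fun v => ?_
    have := quadForm_le_eigMax (posSemidef_normLaplacian G σ β).1 v
    rw [add_mulVec, one_mulVec, dotProduct_add]
    linarith
  · exact le_eigMax (add_one_mem_spectrum (eigMax_mem (posSemidef_normLaplacian G σ β).1))

theorem eigMax_upsilonSq_le {c : ℝ} (h : ∀ i, β i ^ 2 ≤ c) : eigMax (upsilonSq β) ≤ c := by
  refine eigMax_le isHermitian_upsilonSq fun v => ?_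
  simp only [upsilonSq, dotProduct, mulVec_diagonal, Finset.mul_sum]
  exact Finset.sum_le_sum fun i _ => by nlinarith [h i, mul_self_nonneg (v i)]

theorem le_eigMin_upsilonSq {c : ℝ} (h : ∀ i, c ≤ β i ^ 2) : c ≤ eigMin (upsilonSq β) := by
  refine le_eigMin isHermitian_upsilonSq fun v => ?_
  simp only [upsilonSq, dotProduct, mulVec_diagonal, Finset.mul_sum]
  exact Finset.sum_le_sum fun i _ => by nlinarith [h i, mul_self_nonneg (v i)]

include hβ in
theorem eigMin_upsilonSq_pos : 0 < eigMin (upsilonSq β) := by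
  obtain ⟨i, hi⟩ := Finite.exists_min (fun i => β i ^ 2)
  exact (pow_pos (hβ i) 2).trans_le (le_eigMin_upsilonSq hi)

theorem eigMin_le_eigMax {A : Matrix (Fin M) (Fin M) ℝ} (hA : A.IsHermitian) :
    eigMin A ≤ eigMax A := eigMin_le (eigMax_mem hA)

-- The all-ones test vector: its image under Υ is β, where the Laplacian part vanishes.
include hβ in
theorem eigMin_upsilonSq_mul_filterMatrix_le :
    eigMin (upsilonSq β * filterMatrix G σ β) ≤ eigMax (upsilonSq β) := by
  have h1 := eigMin_le_quadForm (isHermitian_upsilonSq_mul_filterMatrix (G := G) (σ := σ) hβ) 1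
  have h2 : (diagonal β *ᵥ (1 : Fin M → ℝ)) = β := by ext i; simp [mulVec_diagonal]
  have h3 := quadForm_le_eigMax (isHermitian_upsilonSq (β := β)) 1
  rw [quadForm_upsilonSq, h2] at h3
  rw [quadForm_upsilonSq_mul_filterMatrix hβ, h2, add_mulVec, normLaplacian,
    ← Matrix.mulVec_mulVec, normIncidence_mulVec_self G σ hβ, mulVec_zero, zero_add,
    one_mulVec] at h1
  exact le_of_mul_le_mul_right (h1.trans h3) (dotProduct_self_pos' one_ne_zero)

include hβ in
theorem le_eigMin_upsilonSq_mul_filterMatrix :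
    eigMin (upsilonSq β) ≤ eigMin (upsilonSq β * filterMatrix G σ β) := by
  refine le_eigMin (isHermitian_upsilonSq_mul_filterMatrix hβ) fun v => ?_
  refine (eigMin_le_quadForm isHermitian_upsilonSq v).trans ?_
  have := PosSemidef.quadForm_nonneg (posSemidef_normLaplacian G σ β) (diagonal β *ᵥ v)
  rw [quadForm_upsilonSq_mul_filterMatrix hβ, quadForm_upsilonSq, add_mulVec, one_mulVec,
    dotProduct_add]
  linarith

include hβ in
theorem eigMax_upsilonSq_mul_filterMatrix_le :
    eigMax (upsilonSq β * filterMatrix G σ β) ≤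
      eigMax (filterMatrix G σ β) * eigMax (upsilonSq β) := by
  refine eigMax_le (isHermitian_upsilonSq_mul_filterMatrix hβ) fun v => ?_
  have h1 := quadForm_le_eigMax (isHermitian_normLaplacian_add_one (G := G) (σ := σ) (β := β))
    (diagonal β *ᵥ v)
  have h2 := quadForm_le_eigMax (isHermitian_upsilonSq (β := β)) v
  have h3 : eigMax (filterMatrix G σ β) = eigMax (normLaplacian G σ β + 1) := by
    rw [eigMax, spectrum_filterMatrix G σ hβ, eigMax]
  have h4 : 0 ≤ eigMax (normLaplacian G σ β + 1) := by
    have := eigMin_filterMatrix (G := G) (σ := σ) hβ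
    have h5 := eigMin_le_eigMax (isHermitian_normLaplacian_add_one (G := G) (σ := σ) (β := β))
    rw [eigMin, spectrum_filterMatrix G σ hβ, ← eigMin] at this
    linarith
  rw [quadForm_upsilonSq_mul_filterMatrix hβ, h3]
  rw [quadForm_upsilonSq] at h2
  nlinarith

-- The test vector is Υ⁻¹u, with u an eigenvector of N + 1 for the eigenvalue t + 1.
omit [Nonempty (Fin M)] in
include hβ in
theorem le_eigMax_upsilonSq_mul_filterMatrix {t : ℝ} (ht0 : 0 ≤ t)
    (ht : t ∈ spectrum ℝ (normLaplacian G σ β)) :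
    (t + 1) * eigMin (upsilonSq β) ≤ eigMax (upsilonSq β * filterMatrix G σ β) := by
  obtain ⟨u, hu, e⟩ := exists_eigenvector (add_one_mem_spectrum ht)
  set v := (diagonal fun i => 1 / β i) *ᵥ u with hv
  have h1 : diagonal β *ᵥ v = u := by
    rw [hv, Matrix.mulVec_mulVec, diagonal_mul_diagonal_inv hβ, one_mulVec]
  have hv0 : v ≠ 0 := fun h => hu (by rw [← h1, h, mulVec_zero])
  have h2 := quadForm_le_eigMax (isHermitian_upsilonSq_mul_filterMatrix (G := G) (σ := σ) hβ) v
  have h3 := eigMin_le_quadForm (isHermitian_upsilonSq (β := β)) v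
  rw [quadForm_upsilonSq_mul_filterMatrix hβ, h1, e, dotProduct_smul, smul_eq_mul] at h2
  rw [quadForm_upsilonSq, h1] at h3
  refine le_of_mul_le_mul_right (le_trans ?_ h2) (dotProduct_self_pos' hv0)
  rw [mul_assoc]
  gcongr

end Eigenvalues

end XFilter

namespace XFilter

/-! ### The algorithm as an inexact primal-dual method. -/

section Convergence

variable {M S : ℕ} {f : Fin M → Vec S → ℝ} {G : SimpleGraph (Fin M)} [DecidableRel G.Adj]
  {L : Fin M → ℝ} {σ : G.edgeSet → ℝ} {β : Fin M → ℝ}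

/-- The normalized variables `z = Υ x`. -/
noncomputable def normVec (β : Fin M → ℝ) : (Fin M → Vec S) →ₗ[ℝ] Blocks (Fin M) S :=
  blockMap (diagonal β) ∘ₗ (WithLp.linearEquiv 2 ℝ (Fin M → Vec S)).symm.toLinearMap

theorem normVec_apply (x : Fin M → Vec S) (i : Fin M) : normVec β x i = β i • x i :=
  blockMap_diagonal β (WithLp.toLp 2 x) i

theorem normVec_act {A B : Matrix (Fin M) (Fin M) ℝ}
    (h : diagonal β * A = B * diagonal β) (x : Fin M → Vec S) :
    normVec β (act A x) = blockMap B (normVec β x) := by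
  change blockMap _ (blockMap A (WithLp.toLp 2 x)) = blockMap B (blockMap _ (WithLp.toLp 2 x))
  rw [← blockMap_mul, ← blockMap_mul, h]

variable (hβ : ∀ i, 0 < β i)
include hβ

theorem norm_filterStep_residual_le [Nonempty (Fin M)] (hb : 1 < eigMax (filterMatrix G σ β))
    (Q : ℕ) (u d : Fin M → Vec S) :
    ‖blockMap (normLaplacian G σ β + 1) (normVec β (filterStep G σ β Q u d)) - normVec β d‖ ≤
      2 * Real.exp (-(2 * Q * √(1 / eigMax (filterMatrix G σ β)))) *
        ‖blockMap (normLaplacian G σ β + 1) (normVec β u) - normVec β d‖ := by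
  have hmin := eigMin_filterMatrix (G := G) (σ := σ) hβ
  have hR := fun x : Fin M → Vec S => normVec_act (diagonal_mul_filterMatrix G σ hβ) x
  have hI : ∀ (τ : ℝ) (x : Fin M → Vec S), normVec β (act (1 - τ • filterMatrix G σ β) x) =
      normVec β x - τ • blockMap (normLaplacian G σ β + 1) (normVec β x) := fun τ x => by
    rw [normVec_act (B := 1 - τ • (normLaplacian G σ β + 1)), blockMap_sub, blockMap_smul,
      blockMap_one]
    rw [Matrix.mul_sub, Matrix.sub_mul, Matrix.mul_smul, Matrix.smul_mul,
      diagonal_mul_filterMatrix G σ hβ, Matrix.mul_one, Matrix.one_mul]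
  set b := eigMax (filterMatrix G σ β) with hbdef
  refine norm_chebyshev_residual_le (blockMap (normLaplacian G σ β + 1)) ?_ hb ?_
    (fun q => normVec β (chebIter (filterMatrix G σ β) (2 / (1 + b)) ((1 - 1 / b) / (1 + 1 / b))
      u d q)) (normVec β d) rfl rfl ?_ ?_ Q |>.trans_eq' ?_
  · intro x y
    rw [inner_blockMap_left]
    rw [← conjTranspose_eq_transpose_of_trivial,
      (isHermitian_normLaplacian_add_one (G := G) (σ := σ) (β := β)).eq]
  · intro x
    have h1 : ((normLaplacian G σ β + 1 - (1 : ℝ) • 1) *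
        (b • 1 - (normLaplacian G σ β + 1))).PosSemidef := by
      refine posSemidef_sub_mul_sub isHermitian_normLaplacian_add_one fun t ht => ?_
      rw [← spectrum_filterMatrix G σ hβ] at ht
      exact ⟨hmin ▸ eigMin_le ht, le_eigMax ht⟩
    have h2 := inner_blockMap_nonneg h1 x
    rw [blockMap_mul, ← conjTranspose_conjTranspose (normLaplacian G σ β + 1 - (1 : ℝ) • 1),
      conjTranspose_eq_transpose_of_trivial, ← inner_blockMap_left,
      conjTranspose_sub, isHermitian_normLaplacian_add_one.eq] at h2
    simpa only [conjTranspose_smul, conjTranspose_one, star_trivial, blockMap_sub, blockMap_smul,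
      blockMap_one, one_smul] using h2
  · simp only [chebIter, map_add, map_smul, hI]
  · intro q
    simp only [chebIter, map_add, map_smul, hI]
  · rw [filterStep, hmin, eigRatio, hmin]

theorem normObjective_normVec (x : Fin M → Vec S) :
    normObjective f β (normVec β x) = objective f x := by
  have : ∀ i, (1 / β i) • normVec β x i = x i := fun i => by
    rw [normVec_apply, smul_smul, one_div_mul_cancel (hβ i).ne', one_smul]
  simp only [normObjective, this]

theorem normGradient_normVec (x : Fin M → Vec S) (i : Fin M) :
    normGradient f β (normVec β x) i = (1 / β i) • gradObjective f x i := by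
  have : ∀ i, (1 / β i) • normVec β x i = x i := fun i => by
    rw [normVec_apply, smul_smul, one_div_mul_cancel (hβ i).ne', one_smul]
  simp only [normGradient, this]

theorem normVec_act_upsilonInvSq (x : Fin M → Vec S) :
    normVec β (act (upsilonInvSq β) (gradObjective f x)) = normGradient f β (normVec β x) := by
  ext i : 1
  have h : act (upsilonInvSq β) (gradObjective f x) i = (1 / β i ^ 2) • gradObjective f x i :=
    blockMap_diagonal _ (WithLp.toLp 2 (gradObjective f x)) i
  rw [normVec_apply, h, smul_smul, normGradient_normVec hβ]
  congr 1
  have := (hβ i).ne'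
  field_simp

/-- The outer iterates in the normalized variables follow an inexact proximal primal-dual method. -/
theorem normVec_state_snd (Q n : ℕ) :
    normVec β (state f G σ β Q n).2 = normVec β (state f G σ β Q n).1 -
      normGradient f β (normVec β (state f G σ β Q n).1) -
      blockMap (normIncidence G σ β)ᵀ (∑ j ∈ Finset.range n,
        blockMap (normIncidence G σ β) (normVec β (state f G σ β Q (j + 1)).1)) := by
  induction n with
  | zero =>
    simp only [state, map_neg, normVec_act_upsilonInvSq hβ, Finset.range_zero, Finset.sum_empty,
      map_zero]
    abel
  | succ n ih =>
    have h1 : (state f G σ β Q (n + 1)).2 = (state f G σ β Q n).2 +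
        (predict f β (state f G σ β Q (n + 1)).1 - predict f β (state f G σ β Q n).1) -
        act (upsilonInvSq β * (scaledIncidence G)ᵀ * sigmaSq σ * scaledIncidence G)
          (state f G σ β Q (n + 1)).1 := rfl
    rw [h1, map_sub, map_add, map_sub, ih, Finset.sum_range_succ, map_add,
      normVec_act (diagonal_mul_laplacian G σ hβ)]
    simp only [predict, map_sub, normVec_act_upsilonInvSq hβ, normLaplacian, blockMap_mul]
    abel

/-- Since β ∈ ker X, the pairing with β does not see the dual term, whatever y is. Cauchy-Schwarz
then produces the factor ∑ βᵢ². -/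
theorem norm_sum_gradient_sq_le (x : Fin M → Vec S) (y : Blocks G.edgeSet S) :
    ‖(1 / (M : ℝ)) • ∑ i, gradient (f i) (x i)‖ ^ 2 ≤ (∑ i, β i ^ 2) *
      ‖normGradient f β (normVec β x) + blockMap (normIncidence G σ β)ᵀ y‖ ^ 2 := by
  set v := normGradient f β (normVec β x) + blockMap (normIncidence G σ β)ᵀ y with hv
  have h1 : ∑ i, β i • blockMap (normIncidence G σ β)ᵀ y i = 0 := by
    simp only [blockMap_apply, Finset.smul_sum, smul_smul]
    rw [Finset.sum_comm]
    refine Finset.sum_eq_zero fun e _ => ?_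
    have h2 := congrFun (normIncidence_mulVec_self G σ hβ) e
    simp only [mulVec, dotProduct, Pi.zero_apply] at h2
    simp only [← Finset.sum_smul, Matrix.transpose_apply]
    rw [Finset.sum_congr rfl fun i _ => mul_comm (β i) _, h2, zero_smul]
  have h2 : (1 / (M : ℝ)) • ∑ i, gradient (f i) (x i) = ∑ i, β i • v i := by
    simp only [hv, PiLp.add_apply, smul_add, Finset.sum_add_distrib, h1, add_zero,
      normGradient_normVec hβ, smul_smul, gradObjective, Finset.smul_sum]
    refine Finset.sum_congr rfl fun i _ => ?_
    rw [← mul_assoc, mul_one_div_cancel (hβ i).ne', one_mul]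
  rw [h2, PiLp.norm_sq_eq_of_L2 _ v]
  have h3 : ‖∑ i, β i • v i‖ ≤ ∑ i, β i * ‖v i‖ := by
    refine (norm_sum_le _ _).trans_eq (Finset.sum_congr rfl fun i _ => ?_)
    rw [norm_smul, Real.norm_eq_abs, abs_of_pos (hβ i)]
  calc _ ≤ (∑ i, β i * ‖v i‖) ^ 2 := by gcongr
    _ ≤ _ := Finset.sum_mul_sq_le_sq_mul_sq _ _ _

theorem sqNorm_act_eq (x : Fin M → Vec S) :
    sqNorm (act (diagonal σ * scaledIncidence G) x) =
      ‖blockMap (normIncidence G σ β) (normVec β x)‖ ^ 2 := by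
  rw [sqNorm_eq, ← normIncidence_mul_diagonal G σ hβ, toLp_act, blockMap_mul]
  rfl

-- This is N² ⪰ mN, with m the least nonzero eigenvalue of N, evaluated as a quadratic form at x.
omit hβ in
theorem norm_blockMap_normIncidence_le (x : Blocks (Fin M) S) :
    eigMinNonzero (normLaplacian G σ β) * ‖blockMap (normIncidence G σ β) x‖ ^ 2 ≤
      ‖blockMap (normIncidence G σ β)ᵀ (blockMap (normIncidence G σ β) x)‖ ^ 2 := by
  have h1 := inner_blockMap_nonneg (posSemidef_mul_self_sub (posSemidef_normLaplacian G σ β)) x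
  have h2 : (normLaplacian G σ β)ᵀ = normLaplacian G σ β := by
    rw [normLaplacian, transpose_mul, transpose_transpose]
  rw [blockMap_sub, blockMap_smul, inner_sub_right, inner_smul_right, blockMap_mul] at h1
  nth_rewrite 1 [← h2] at h1
  rw [← inner_blockMap_left, real_inner_self_eq_norm_sq] at h1
  rw [← blockMap_mul, ← real_inner_self_eq_norm_sq (blockMap _ x), inner_blockMap_left,
    ← blockMap_mul]
  change _ * inner ℝ x (blockMap (normLaplacian G σ β) x) ≤ ‖blockMap (normLaplacian G σ β) x‖ ^ 2
  linarith

theorem mul_errorMeasure_le [Nonempty (Fin M)] (hf : ProblemClass f L)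
    (hB : ∀ i, 96 / M * L i ≤ β i ^ 2) (hev : eigMinNonzero (normLaplacian G σ β) = 48)
    (hb : 1 < eigMax (filterMatrix G σ β))
    (hQ : (2 * Real.exp (-(2 * innerCount G σ β * √(1 / eigMax (filterMatrix G σ β))))) ^ 2 ≤
      1 / 17000) (T : ℕ) :
    T * errorMeasure f G σ β T ≤ constOne f G L σ β * (21 / 5 * ∑ i, β i ^ 2 + 1) := by
  set Q := innerCount G σ β
  set X := normIncidence G σ β with hX
  set z : ℕ → Blocks (Fin M) S := fun n => normVec β (state f G σ β Q n).1 with hz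
  set μ : ℕ → Blocks G.edgeSet S := fun n => ∑ j ∈ Finset.range n, blockMap X (z (j + 1)) with hμ
  have hmain := inexact_proximal_primal_dual (blockMap X) (blockMap Xᵀ)
    (inner_blockMap_left X)
    (fun x => by rw [← hev]; exact norm_blockMap_normIncidence_le x)
    (normObjective f β) (normGradient f β) (c := objectiveInf f)
    (fun x => ciInf_le hf.bddBelow _) (normObjective_le hf hβ hB)
    (norm_normGradient_sub_le hf hβ hB) z μ (by simp [hz, state]) (by simp [hμ])
    (fun n => by simp only [hμ, Finset.sum_range_succ]) hQ ?_ T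
  · obtain ⟨h1, h2⟩ := hmain
    have hz1 : normObjective f β (z 1) = objective f (iterate f G σ β 0) :=
      normObjective_normVec hβ _
    have hC : normObjective f β (z 1) - objectiveInf f + ‖normGradient f β 0‖ ^ 2 ≤
        constOne f G L σ β := by
      rw [hz1, constOne]
      have := norm_normGradient_zero_sq_le hf hβ hB
      linarith
    set E : ℕ → ℝ := fun r => ‖(1 / (M : ℝ)) • ∑ i, gradient (f i) (iterate f G σ β r i)‖ ^ 2 +
      sqNorm (act (diagonal σ * scaledIncidence G) (iterate f G σ β r)) with hE
    have hE0 : ∀ r, 0 ≤ E r := fun r => by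
      simp only [hE, sqNorm_eq]
      positivity
    have h3 : ∀ r ∈ Finset.range T, errorMeasure f G σ β T ≤ E (r + 1) := by
      intro r hr
      exact ciInf_le (f := fun r : Set.Icc 1 T => E r)
        ⟨0, by rintro _ ⟨r, rfl⟩; exact hE0 _⟩
        ⟨r + 1, Nat.succ_le_succ (Nat.zero_le r), Finset.mem_range.1 hr⟩
    -- `iterate` at `r` is `state` at `r + 1`, so the indices 1, …, T of the error measure are `z
    -- 2`, …, `z (T + 1)`, those summed in `hmain`.
    have h4 : ∀ r, E (r + 1) ≤ (∑ i, β i ^ 2) *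
        ‖normGradient f β (z (r + 2)) + blockMap Xᵀ (μ (r + 2))‖ ^ 2 +
          ‖blockMap X (z (r + 2))‖ ^ 2 := by
      intro r
      simp only [hE]
      rw [sqNorm_act_eq hβ]
      gcongr
      · exact norm_sum_gradient_sq_le hβ _ _
      · exact le_rfl
    have h5 : T * errorMeasure f G σ β T ≤ ∑ r ∈ Finset.range T, E (r + 1) := by
      simpa using Finset.card_nsmul_le_sum _ _ _ h3
    refine h5.trans ((Finset.sum_le_sum fun r _ => h4 r).trans ?_)
    rw [Finset.sum_add_distrib, ← Finset.mul_sum]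
    have h6 : 0 ≤ ∑ i, β i ^ 2 := Finset.sum_nonneg fun i _ => sq_nonneg _
    have h7 := mul_le_mul_of_nonneg_left (h1.trans (mul_le_mul_of_nonneg_left hC (by norm_num))) h6
    linarith
  · intro n
    have h1 : ‖blockMap (normLaplacian G σ β + 1) (z (n + 1)) - normVec β (state f G σ β Q n).2‖ ≤
        2 * Real.exp (-(2 * Q * √(1 / eigMax (filterMatrix G σ β)))) *
        ‖blockMap (normLaplacian G σ β + 1) (z n) - normVec β (state f G σ β Q n).2‖ :=
      norm_filterStep_residual_le hβ hb Q (state f G σ β Q n).1 (state f G σ β Q n).2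
    have h2 : normVec β (state f G σ β Q n).2 = z n - normGradient f β (z n) - blockMap Xᵀ (μ n) :=
      normVec_state_snd hβ Q n
    have h3 : ∀ y : Blocks (Fin M) S,
        blockMap (normLaplacian G σ β + 1) y = blockMap Xᵀ (blockMap X y) + y := fun y => by
      rw [blockMap_add, blockMap_one, normLaplacian, blockMap_mul]
    have h4 : blockMap Xᵀ (μ (n + 1)) = blockMap Xᵀ (μ n) + blockMap Xᵀ (blockMap X (z (n + 1))) := by
      simp only [hμ, Finset.sum_range_succ, map_add]
    rw [h2, h3, h3] at h1
    -- The residual of the inner linear system is the optimality residual of the primal-dual step at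
    -- its end point; `h6` does the same at its starting point.
    have h5 : normGradient f β (z n) + blockMap Xᵀ (μ (n + 1)) + (z (n + 1) - z n) =
        blockMap Xᵀ (blockMap X (z (n + 1))) + z (n + 1) -
          (z n - normGradient f β (z n) - blockMap Xᵀ (μ n)) := by
      rw [h4]
      abel
    have h6 : blockMap Xᵀ (blockMap X (z n)) + normGradient f β (z n) + blockMap Xᵀ (μ n) =
        blockMap Xᵀ (blockMap X (z n)) + z n -
          (z n - normGradient f β (z n) - blockMap Xᵀ (μ n)) := by
      abel
    rw [h5, h6]
    exact h1

end Convergence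

end XFilter

namespace XFilter

/-! ### Iteration counts from the normalized parameters. -/

section Rate

variable {M S : ℕ} {f : Fin M → Vec S → ℝ} {G : SimpleGraph (Fin M)} [DecidableRel G.Adj]
  {L : Fin M → ℝ} {σ : G.edgeSet → ℝ} {β : Fin M → ℝ}

/-- The quotient whose logarithm determines the inner iteration number. -/
noncomputable def innerArg (G : SimpleGraph (Fin M)) [DecidableRel G.Adj] (σ : G.edgeSet → ℝ)
    (β : Fin M → ℝ) : ℝ :=
  (16 + 128 * (M : ℝ) * max (eigMax (upsilonSq β * filterMatrix G σ β)) 1) / thetaConst G σ β ^ 2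

/-- The inner iteration number before rounding. -/
noncomputable def innerReal (G : SimpleGraph (Fin M)) [DecidableRel G.Adj] (σ : G.edgeSet → ℝ)
    (β : Fin M → ℝ) : ℝ :=
  1 / 4 * Real.log (innerArg G σ β) * √(1 / eigRatio (filterMatrix G σ β))

theorem innerCount_eq : innerCount G σ β = ⌈innerReal G σ β⌉₊ := by
  have h : thetaConst G σ β ^ 2 /
      (16 + 128 * (M : ℝ) * max (eigMax (upsilonSq β * filterMatrix G σ β)) 1) =
      (innerArg G σ β)⁻¹ := by rw [innerArg, inv_div]
  rw [innerCount, innerReal, h, Real.log_inv, neg_mul_neg]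

theorem sum_sq_nonneg : 0 ≤ ∑ i, β i ^ 2 := Finset.sum_nonneg fun _ _ => sq_nonneg _

theorem constOne_nonneg (hf : ProblemClass f L) : 0 ≤ constOne f G L σ β := by
  have h1 : objectiveInf f ≤ objective f (iterate f G σ β 0) := ciInf_le hf.bddBelow _
  have h2 : 0 ≤ 5 / (M : ℝ) * ∑ i, ‖gradient (f i) 0‖ ^ 2 / L i :=
    mul_nonneg (by positivity)
      (Finset.sum_nonneg fun i _ => div_nonneg (sq_nonneg _) (hf.lip_pos i).le)
  rw [constOne]
  linarith

theorem constTwo_eq (hev : eigMinNonzero (normLaplacian G σ β) = 48) :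
    constTwo G σ β = 128 * (∑ i, β i ^ 2 + 9 / 2) := by
  rw [constTwo, kappaTilde_eq, hev]
  norm_num
  ring

/-- With κ̃ = 1/48 the coefficients in the second condition are 1/48, 4/3 and 1/8. The Laplacian
part of Υ²R is positive semidefinite, and what remains is a diagonal inequality with ample slack. -/
theorem parameterConditions_of_normalized (hM : 0 < M) (hL : ∀ i, 0 < L i) (hβ : ∀ i, 0 < β i)
    (hB : ∀ i, 96 / M * L i ≤ β i ^ 2) (hev : eigMinNonzero (normLaplacian G σ β) = 48) :
    ParameterConditions G L σ β := by
  have hM' : (0 : ℝ) < M := by exact_mod_cast hM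
  have hLL : lipMatrix L * upsilonInvSq β * lipMatrix L = diagonal fun i => L i ^ 2 / β i ^ 2 := by
    rw [lipMatrix, upsilonInvSq, diagonal_mul_diagonal, diagonal_mul_diagonal]
    congr 1
    ext i
    ring
  have hq : ∀ i, 1 / (M : ℝ) ^ 2 * (L i ^ 2 / β i ^ 2) ≤ 1 / 96 * (1 / M * L i) := fun i => by
    have := lipschitz_scaled_le hM' (hβ i) (hB i)
    have h2 : 0 ≤ 1 / (M : ℝ) * L i := by have := hL i; positivity
    calc _ = 1 / (M : ℝ) * (L i * (1 / β i) ^ 2) * (1 / M * L i) := by ring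
      _ ≤ _ := by gcongr
  have hL' : ∀ i, 0 ≤ 1 / (M : ℝ) * L i := fun i => by have := hL i; positivity
  have hB' : ∀ i, 96 * (1 / (M : ℝ) * L i) ≤ β i ^ 2 := fun i => by
    have := hB i
    calc _ = 96 / (M : ℝ) * L i := by ring
      _ ≤ _ := this
  rw [ParameterConditions, kappaTilde_eq, hev]
  refine ⟨?_, ?_⟩
  · rw [hLL, upsilonSq, ← diagonal_smul, diagonal_sub, posSemidef_diagonal_iff]
    intro i
    have h1 := hq i
    have h2 := hL' i
    have h3 := hB' i
    simp only [Pi.smul_apply, smul_eq_mul]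
    linarith
  · have h1 : upsilonSq β * filterMatrix G σ β =
        diagonal β * normLaplacian G σ β * diagonal β + upsilonSq β := by
      rw [upsilonSq_mul_filterMatrix G σ hβ, Matrix.mul_add, Matrix.add_mul, Matrix.mul_one,
        diagonal_mul_diagonal, upsilonSq]
      simp only [sq]
    have h2 : (diagonal β * normLaplacian G σ β * diagonal β).PosSemidef := by
      simpa using (posSemidef_normLaplacian G σ β).conjTranspose_mul_mul_same (diagonal β)
    have h3 : ((1 / 48 : ℝ) • upsilonSq β - ((4 / 3 : ℝ) / M) • lipMatrix L -
        ((1 / 8 : ℝ) / M ^ 2) • (lipMatrix L * upsilonInvSq β * lipMatrix L)).PosSemidef := by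
      rw [hLL, upsilonSq, lipMatrix, ← diagonal_smul, ← diagonal_smul, ← diagonal_smul,
        diagonal_sub, diagonal_sub, posSemidef_diagonal_iff]
      intro i
      have h1 := hq i
      have h2 := hL' i
      have h3 := hB' i
      have h4 : (4 / 3 : ℝ) / M * L i = 4 / 3 * (1 / M * L i) := by ring
      have h5 : (1 / 8 : ℝ) / M ^ 2 * (L i ^ 2 / β i ^ 2) =
        1 / 8 * (1 / (M : ℝ) ^ 2 * (L i ^ 2 / β i ^ 2)) := by ring
      simp only [Pi.smul_apply, smul_eq_mul]
      rw [h4, h5]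
      linarith
    have h4 := (h2.smul (show (0 : ℝ) ≤ 1 / 48 by norm_num)).add h3
    convert h4 using 1
    rw [h1]
    norm_num [smul_add]
    abel

variable [Nonempty (Fin M)]

theorem fortyNine_le_eigMax (hβ : ∀ i, 0 < β i)
    (hev : eigMinNonzero (normLaplacian G σ β) = 48) : 49 ≤ eigMax (filterMatrix G σ β) := by
  rw [eigMax_filterMatrix hβ]
  have h := eigMinNonzero_mem (A := normLaplacian G σ β) (by rw [hev]; norm_num)
  rw [hev] at h
  linarith [le_eigMax h.1]

/-- The upper bound uses λ_max(Υ²R) ≥ 49 λ_min(Υ²), from the eigenvalue 48 of N, and λ_min(Υ²R) ≤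
λ_max(Υ²); the conditioning of Υ² then cancels. -/
theorem thetaConst_bounds (hβ : ∀ i, 0 < β i)
    (hev : eigMinNonzero (normLaplacian G σ β) = 48) :
    0 < thetaConst G σ β ∧ thetaConst G σ β ≤ 1 / 49 := by
  have h := eigMinNonzero_mem (A := normLaplacian G σ β) (by rw [hev]; norm_num)
  rw [hev] at h
  have h1 := eigMin_upsilonSq_pos hβ
  have h2 := eigMin_le_eigMax (isHermitian_upsilonSq (β := β))
  have h3 := le_eigMin_upsilonSq_mul_filterMatrix (G := G) (σ := σ) hβ
  have h4 := le_eigMax_upsilonSq_mul_filterMatrix hβ (by norm_num) h.1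
  have h5 := eigMin_upsilonSq_mul_filterMatrix_le (G := G) (σ := σ) hβ
  rw [thetaConst, eigRatio, eigRatio]
  generalize eigMin (upsilonSq β) = p at *
  generalize eigMax (upsilonSq β) = P at *
  generalize eigMin (upsilonSq β * filterMatrix G σ β) = q at *
  generalize eigMax (upsilonSq β * filterMatrix G σ β) = r at *
  have hP : 0 < P := by linarith
  have hq : 0 < q := by linarith
  have hr : 0 < r := by linarith
  have hm : 0 < min 1 p := lt_min one_pos h1
  refine ⟨by positivity, ?_⟩
  calc q / r * (p / P) * min 1 p ≤ P / (49 * p) * (p / P) * 1 := by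
        gcongr
        · linarith
        · exact min_le_left _ _
    _ = 1 / 49 := by field_simp

/-- The number 68000 is 4 · 17000, the 4 being the square of the factor 2 in the Chebyshev bound. -/
theorem le_innerArg (hM : 2 ≤ M) (hβ : ∀ i, 0 < β i)
    (hev : eigMinNonzero (normLaplacian G σ β) = 48) : 68000 ≤ innerArg G σ β := by
  obtain ⟨h0, h1⟩ := thetaConst_bounds hβ hev
  have hM' : (2 : ℝ) ≤ M := by exact_mod_cast hM
  have h2 := le_max_right (eigMax (upsilonSq β * filterMatrix G σ β)) 1
  rw [innerArg, le_div_iff₀ (by positivity)]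
  nlinarith [mul_le_mul hM' h2 (by norm_num) (by positivity)]

theorem one_le_innerReal (hM : 2 ≤ M) (hβ : ∀ i, 0 < β i)
    (hev : eigMinNonzero (normLaplacian G σ β) = 48) : 1 ≤ innerReal G σ β := by
  have h1 := le_innerArg hM hβ hev
  have h2 : 4 ≤ Real.log (innerArg G σ β) := by
    rw [Real.le_log_iff_exp_le (by linarith)]
    have h3 : Real.exp 4 = Real.exp 1 ^ 4 := by rw [← Real.exp_nat_mul]; norm_num
    have h4 : Real.exp 1 ^ 4 ≤ 3 ^ 4 := by
      gcongr
      exact Real.exp_one_lt_three.le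
    linarith
  have h5 := fortyNine_le_eigMax hβ hev
  have h6 : 1 ≤ √(1 / eigRatio (filterMatrix G σ β)) := by
    rw [eigRatio, eigMin_filterMatrix hβ, one_div_one_div, Real.one_le_sqrt]
    linarith
  rw [innerReal]
  nlinarith

theorem residual_factor_le (hM : 2 ≤ M) (hβ : ∀ i, 0 < β i)
    (hev : eigMinNonzero (normLaplacian G σ β) = 48) :
    (2 * Real.exp (-(2 * innerCount G σ β * √(1 / eigMax (filterMatrix G σ β))))) ^ 2 ≤
      1 / 17000 := by
  have h1 := le_innerArg hM hβ hev
  have h2 : innerReal G σ β ≤ innerCount G σ β := by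
    rw [innerCount_eq]
    exact Nat.le_ceil _
  have h3 := fortyNine_le_eigMax hβ hev
  set b := eigMax (filterMatrix G σ β) with hb
  have h4 : √b * √(1 / b) = 1 := by
    rw [← Real.sqrt_mul (by linarith), mul_one_div_cancel (by linarith), Real.sqrt_one]
  have h5 : Real.log (innerArg G σ β) ≤ 4 * innerCount G σ β * √(1 / b) := by
    rw [innerReal, eigRatio, eigMin_filterMatrix hβ, one_div_one_div, ← hb] at h2
    have := mul_le_mul_of_nonneg_right h2 (Real.sqrt_nonneg (1 / b))
    rw [mul_assoc, h4] at this
    linarith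
  rw [mul_pow, ← Real.exp_nat_mul]
  have h6 : Real.exp ((2 : ℕ) * -(2 * innerCount G σ β * √(1 / b))) ≤ (innerArg G σ β)⁻¹ := by
    rw [← Real.exp_log (inv_pos.2 (show 0 < innerArg G σ β by linarith)), Real.log_inv]
    apply Real.exp_le_exp.2
    push_cast
    linarith
  have h7 : (innerArg G σ β)⁻¹ ≤ 68000⁻¹ := by gcongr
  linarith

theorem reachesWithin_of_innerReal_le (hM : 2 ≤ M) (hf : ProblemClass f L) (hβ : ∀ i, 0 < β i)
    (hB : ∀ i, 96 / M * L i ≤ β i ^ 2) (hev : eigMinNonzero (normLaplacian G σ β) = 48)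
    {ε : ℝ} (hε : 0 < ε) {q : ℝ} (hq : innerReal G σ β ≤ 2 * q) :
    ReachesWithin f G σ β ε (1 / ε * constOne f G L σ β * constTwo G σ β * q) := by
  have hb := fortyNine_le_eigMax hβ hev
  have hC1 := constOne_nonneg (G := G) (σ := σ) (β := β) hf
  have hq1 := one_le_innerReal hM hβ hev
  have hs := sum_sq_nonneg (β := β)
  -- The divisor 30 is admissible because 128/30 ≥ 21/5 and 128 · (9/2)/30 ≥ 1.
  have hmain : ∀ T : ℕ, T * errorMeasure f G σ β T ≤
      constOne f G L σ β * constTwo G σ β / 30 := by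
    intro T
    refine (mul_errorMeasure_le hβ hf hB hev (by linarith) (residual_factor_le hM hβ hev) T).trans ?_
    rw [constTwo_eq hev, mul_div_assoc]
    exact mul_le_mul_of_nonneg_left (by linarith) hC1
  set K := constOne f G L σ β * constTwo G σ β with hK
  rw [mul_assoc (1 / ε), ← hK, one_div_mul_eq_div]
  -- As `innerReal` is at least 1, rounding up at most doubles it.
  have hQ : (innerCount G σ β : ℝ) ≤ 4 * q := by
    rw [innerCount_eq]
    have := Nat.ceil_lt_add_one (show 0 ≤ innerReal G σ β by linarith)
    linarith
  -- If K/ε ≤ 30, the iterate x¹ already meets the tolerance, at the minimal cost. Otherwise K/(30ε)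
  -- > 1, so the ceiling plus one is at most K/(30ε) + 2 ≤ K/(10ε).
  rcases le_or_gt (K / ε) 30 with h | h
  · refine ⟨1, le_rfl, ?_, le_max_right _ _⟩
    have := hmain 1
    rw [div_le_iff₀ hε] at h
    push_cast at this
    linarith
  · have hT : 0 < ⌈K / ε / 30⌉₊ := Nat.ceil_pos.2 (by linarith)
    refine ⟨⌈K / ε / 30⌉₊, hT, ?_, ?_⟩
    · have h1 := hmain ⌈K / ε / 30⌉₊
      have h2 := Nat.le_ceil (K / ε / 30)
      have h3 : (0 : ℝ) < ⌈K / ε / 30⌉₊ := by exact_mod_cast hT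
      have h4 : K / 30 ≤ ⌈K / ε / 30⌉₊ * ε := by
        calc K / 30 = K / ε / 30 * ε := by field_simp
          _ ≤ _ := by gcongr
      exact le_of_mul_le_mul_left (h1.trans h4) h3
    · refine le_trans ?_ (le_max_left _ _)
      rw [totalIterations]
      push_cast
      have h2 := Nat.ceil_lt_add_one (show 0 ≤ K / ε / 30 by linarith)
      calc (innerCount G σ β : ℝ) * (⌈K / ε / 30⌉₊ + 1) ≤ 4 * q * (K / ε / 10) := by
            gcongr
            · linarith
            · linarith
        _ ≤ K / ε * q := by nlinarith

/-- Here ρ bounds the condition number of Υ², and μ replaces min{1, λ_min(Υ²)}² but may be too large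
by the factor c². With y the argument of the logarithm on the right, direct estimates give
`innerArg` ≤ c²y. Since c² ≤ y this is at most y², whose logarithm supplies the factor 2. -/
theorem innerReal_le (hM : 0 < M) (hβ : ∀ i, 0 < β i) {ξ ρ c V μ : ℝ} (hξ0 : 0 < ξ) (hξ1 : ξ ≤ 1)
    (hb : eigMax (normLaplacian G σ β) = 48 / ξ)
    (hev : eigMinNonzero (normLaplacian G σ β) = 48) (hc : 1 ≤ c) (hcρ : c ≤ ρ)
    (hρ : eigMax (upsilonSq β) ≤ ρ * eigMin (upsilonSq β)) (hV : 50 * eigMax (upsilonSq β) ≤ V)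
    (hμ0 : 0 < μ) (hμ1 : μ ≤ 1) (hμ : μ ≤ c ^ 2 * min 1 (eigMin (upsilonSq β)) ^ 2) :
    innerReal G σ β ≤ 2 * (1 / 4 * Real.log
      (50 ^ 2 * ρ ^ 4 * (16 + 128 * (M : ℝ) * max V 1) / (ξ ^ 3 * μ)) * √(50 / ξ)) := by
  have hM' : (1 : ℝ) ≤ M := by exact_mod_cast hM
  have hb1 : eigMax (filterMatrix G σ β) ≤ 50 / ξ := by
    rw [eigMax_filterMatrix hβ, hb, div_add_one hξ0.ne']
    gcongr
    linarith
  have hb0 := fortyNine_le_eigMax hβ hev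
  have h1 := eigMin_upsilonSq_pos hβ
  have h2 := eigMin_le_eigMax (isHermitian_upsilonSq (β := β))
  have h3 := le_eigMin_upsilonSq_mul_filterMatrix (G := G) (σ := σ) hβ
  have h4 := eigMax_upsilonSq_mul_filterMatrix_le (G := G) (σ := σ) hβ
  have h5 := eigMin_le_eigMax (isHermitian_upsilonSq_mul_filterMatrix (G := G) (σ := σ) hβ)
  have hθ0 := (thetaConst_bounds hβ hev).1
  have hρ1 : 1 ≤ ρ := hc.trans hcρ
  have hH : eigMax (upsilonSq β * filterMatrix G σ β) ≤ 50 / ξ * eigMax (upsilonSq β) :=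
    h4.trans (mul_le_mul_of_nonneg_right hb1 (by linarith))
  have hm : 0 < min 1 (eigMin (upsilonSq β)) := lt_min one_pos h1
  have hθ : ξ / (50 * ρ ^ 2) * min 1 (eigMin (upsilonSq β)) ≤ thetaConst G σ β := by
    rw [thetaConst, eigRatio, eigRatio]
    generalize eigMin (upsilonSq β) = p at *
    generalize eigMax (upsilonSq β) = P at *
    generalize eigMin (upsilonSq β * filterMatrix G σ β) = q at *
    generalize eigMax (upsilonSq β * filterMatrix G σ β) = r at *
    have hP : 0 < P := by linarith
    have hr : 0 < r := by linarith
    have hq : 0 ≤ q := by linarith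
    have hqr : 0 ≤ q / r := by positivity
    have e1 : 1 / ρ ≤ p / P := by
      rw [div_le_div_iff₀ (by linarith) hP]
      linarith
    have e2 : ξ / 50 * (1 / ρ) ≤ q / r := by
      calc ξ / 50 * (1 / ρ) ≤ ξ / 50 * (p / P) := by gcongr
        _ = p / (50 / ξ * P) := by field_simp
        _ ≤ q / r := by gcongr
    calc _ = ξ / 50 * (1 / ρ) * (1 / ρ) * min 1 p := by field_simp
      _ ≤ _ := by gcongr
  have hθ2 : ξ ^ 2 * μ ≤ thetaConst G σ β ^ 2 * (50 ^ 2 * ρ ^ 4 * c ^ 2) := by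
    have e1 : (ξ / (50 * ρ ^ 2) * min 1 (eigMin (upsilonSq β))) ^ 2 ≤ thetaConst G σ β ^ 2 := by
      gcongr
    calc ξ ^ 2 * μ ≤ ξ ^ 2 * (c ^ 2 * min 1 (eigMin (upsilonSq β)) ^ 2) := by gcongr
      _ = (ξ / (50 * ρ ^ 2) * min 1 (eigMin (upsilonSq β))) ^ 2 * (50 ^ 2 * ρ ^ 4 * c ^ 2) := by
        field_simp
      _ ≤ _ := by gcongr
  have hD : 16 + 128 * (M : ℝ) * max (eigMax (upsilonSq β * filterMatrix G σ β)) 1 ≤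
      (16 + 128 * (M : ℝ) * max V 1) / ξ := by
    have e1 : max (eigMax (upsilonSq β * filterMatrix G σ β)) 1 ≤ max V 1 / ξ := by
      apply max_le
      · refine hH.trans ?_
        rw [div_mul_eq_mul_div]
        gcongr
        exact hV.trans (le_max_left _ _)
      · rw [le_div_iff₀ hξ0, one_mul]
        exact hξ1.trans (le_max_right _ _)
    rw [add_div, mul_div_assoc]
    gcongr
    rw [le_div_iff₀ hξ0]
    linarith
  have hD1 : 1 ≤ 16 + 128 * (M : ℝ) * max V 1 := by
    have := le_max_right V 1
    nlinarith
  set D := 16 + 128 * (M : ℝ) * max V 1 with hDdef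
  set y := 50 ^ 2 * ρ ^ 4 * D / (ξ ^ 3 * μ) with hy
  have hD0 : 0 < D := by linarith
  have hρ0 : 0 < ρ := by linarith
  have hy0 : 0 < y := by positivity
  have hcy : c ^ 2 ≤ y := by
    rw [hy, le_div_iff₀ (by positivity)]
    have e1 : ξ ^ 3 * μ ≤ 1 := mul_le_one₀ (pow_le_one₀ hξ0.le hξ1) hμ0.le hμ1
    calc c ^ 2 * (ξ ^ 3 * μ) ≤ ρ ^ 2 * 1 := by gcongr
      _ ≤ ρ ^ 4 * 1 := by
        gcongr
        norm_num
      _ ≤ ρ ^ 4 * (50 ^ 2 * D) := by gcongr; linarith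
      _ = _ := by ring
  have harg : innerArg G σ β ≤ y ^ 2 := by
    rw [innerArg, div_le_iff₀ (by positivity)]
    calc _ ≤ D / ξ := hD
      _ = D / (ξ ^ 3 * μ) * (ξ ^ 2 * μ) := by field_simp
      _ ≤ D / (ξ ^ 3 * μ) * (thetaConst G σ β ^ 2 * (50 ^ 2 * ρ ^ 4 * c ^ 2)) := by gcongr
      _ = y * c ^ 2 * thetaConst G σ β ^ 2 := by rw [hy]; ring
      _ ≤ y * y * thetaConst G σ β ^ 2 := by gcongr
      _ = _ := by ring
  have hargpos : 0 < innerArg G σ β := by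
    rw [innerArg]
    have := le_max_right (eigMax (upsilonSq β * filterMatrix G σ β)) 1
    positivity
  have hlog : Real.log (innerArg G σ β) ≤ 2 * Real.log y := by
    have := Real.log_le_log hargpos harg
    rwa [Real.log_pow] at this
  have hy1 : 0 ≤ Real.log y := Real.log_nonneg (by nlinarith)
  have hsq : √(1 / eigRatio (filterMatrix G σ β)) ≤ √(50 / ξ) := by
    rw [eigRatio, eigMin_filterMatrix hβ, one_div_one_div]
    exact Real.sqrt_le_sqrt hb1
  rw [innerReal]
  calc _ ≤ 1 / 4 * (2 * Real.log y) * √(50 / ξ) := by gcongr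
    _ = _ := by ring

end Rate

end XFilter

namespace XFilter

/-! ### The two parameter choices as rescaled Laplacians. -/

section Cases

variable {M : ℕ} {G : SimpleGraph (Fin M)} [DecidableRel G.Adj]
  {L : Fin M → ℝ} {σ : G.edgeSet → ℝ} {β : Fin M → ℝ}

theorem lipMin_le (i : Fin M) : lipMin L ≤ L i := ciInf_le (Set.finite_range L).bddBelow i

theorem le_lipMax (i : Fin M) : L i ≤ lipMax L := le_ciSup (Set.finite_range L).bddAbove i

theorem lipMin_pos [Nonempty (Fin M)] (hL : ∀ i, 0 < L i) : 0 < lipMin L := by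
  obtain ⟨i, hi⟩ := Finite.exists_min L
  exact (hL i).trans_le (le_ciInf hi)

/-- If the normalized Laplacian is `48 / m` times a matrix with least nonzero eigenvalue `m`, its
extreme nonzero eigenvalues are `48` and `48 / ξ`. -/
theorem eig_normLaplacian_of_eq_smul {A : Matrix (Fin M) (Fin M) ℝ} (hm : 0 < eigMinNonzero A)
    (h : normLaplacian G σ β = (48 / eigMinNonzero A) • A) :
    eigMinNonzero (normLaplacian G σ β) = 48 ∧
      eigMax (normLaplacian G σ β) = 48 / spectralGap A ∧ 0 < spectralGap A ∧
      spectralGap A ≤ 1 := by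
  have hc : 0 < 48 / eigMinNonzero A := by positivity
  have h1 : eigMinNonzero A ≤ eigMax A := le_eigMax (eigMinNonzero_mem hm.ne').1
  have h2 : 0 < eigMax A := by linarith
  refine ⟨?_, ?_, div_pos hm h2, (div_le_one h2).2 h1⟩
  · rw [h, eigMinNonzero_smul hc]
    field_simp
  · rw [h, eigMax_smul hc, spectralGap]
    field_simp

omit [DecidableRel G.Adj] in
/-- The scaling of the penalty parameters forces the eigenvalue in their definition to be
positive, as the graph has an edge. -/
theorem pos_of_sigmaSq_eq {c m : ℝ} (hc : 0 ≤ c) (e : G.edgeSet) (hσ : 0 < σ e)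
    (h : sigmaSq σ = (c / m) • edgeLip G L) : 0 < m := by
  have h1 := congrFun (congrFun h e) e
  simp only [sigmaSq, edgeLip, diagonal_apply_eq, Matrix.smul_apply, smul_eq_mul] at h1
  by_contra hm
  have h2 : c / m ≤ 0 := div_nonpos_of_nonneg_of_nonpos hc (not_lt.1 hm)
  have h3 := mul_nonpos_of_nonpos_of_nonneg h2
    (Real.sqrt_nonneg (L (e : Sym2 (Fin M)).sup * L (e : Sym2 (Fin M)).inf))
  nlinarith [pow_pos hσ 2]

/-- Covers both cases at once: wᵢ = dᵢLᵢ gives 𝓛̃ and wᵢ = Lᵢ gives 𝓛̂. -/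
theorem normLaplacian_eq_smul {s t : ℝ} {w : Fin M → ℝ} (ht : 0 < t) (hβ : ∀ i, 0 < β i)
    (hw : ∀ i, β i ^ 2 = t * w i) (h : sigmaSq σ = s • edgeLip G L) :
    normLaplacian G σ β = (s / t) • ((diagonal fun i => 1 / √(w i)) * (scaledIncidence G)ᵀ *
      edgeLip G L * scaledIncidence G * diagonal fun i => 1 / √(w i)) := by
  have h1 : (diagonal fun i => 1 / β i) = (1 / √t) • diagonal fun i => 1 / √(w i) := by
    rw [← diagonal_smul]
    congr 1
    ext i
    rw [← Real.sqrt_sq (hβ i).le, hw, Real.sqrt_mul ht.le, Pi.smul_apply, smul_eq_mul,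
      div_mul_div_comm, one_mul]
  have h2 : 1 / √t * (1 / √t) = 1 / t := by
    rw [div_mul_div_comm, Real.mul_self_sqrt ht.le, one_mul]
  rw [normLaplacian_eq, h1, h]
  simp only [Matrix.smul_mul, Matrix.mul_smul, smul_smul]
  congr 1
  rw [mul_left_comm, h2, mul_one_div]

theorem tildeLaplacian_eq : tildeLaplacian G L =
    (diagonal fun i => 1 / √(G.degree i * L i)) * (scaledIncidence G)ᵀ * edgeLip G L *
      scaledIncidence G * diagonal fun i => 1 / √(G.degree i * L i) := by
  have h1 : lipInvSqrt L * degInvSqrt G = diagonal fun i => 1 / √(G.degree i * L i) := by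
    rw [lipInvSqrt, degInvSqrt, diagonal_mul_diagonal]
    congr 1
    ext i
    rw [Real.sqrt_mul (by positivity), div_mul_div_comm, one_mul, mul_comm]
  have h2 : degInvSqrt G * lipInvSqrt L = diagonal fun i => 1 / √(G.degree i * L i) := by
    rw [← h1, lipInvSqrt, degInvSqrt, diagonal_mul_diagonal, diagonal_mul_diagonal]
    simp only [mul_comm]
  rw [tildeLaplacian, h1, Matrix.mul_assoc, h2]

end Cases

end XFilter

/-! ### The main theorem. -/

open XFilter

theorem theorem6p2 {M S : ℕ} (hM : 2 ≤ M)
    (G : SimpleGraph (Fin M)) [DecidableRel G.Adj] (hG : G.Connected)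
    (f : Fin M → XFilter.Vec S → ℝ) (L : Fin M → ℝ) (hf : XFilter.ProblemClass f L)
    (σ : G.edgeSet → ℝ) (hσ : ∀ e, 0 < σ e) (β : Fin M → ℝ) (hβ : ∀ i, 0 < β i) :
    -- Case I
    (∀ k : ℝ, 0 < k →
      (k • XFilter.degMatrix G
        - XFilter.avgDegree G • (1 : Matrix (Fin M) (Fin M) ℝ)).PosSemidef →
      XFilter.sigmaSq σ =
        (48 * 96 * k / ((∑ i, (G.degree i : ℝ)) *
          XFilter.eigMinNonzero (XFilter.tildeLaplacian G L))) • XFilter.edgeLip G L →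
      XFilter.upsilonSq β =
        (96 * k / ∑ i, (G.degree i : ℝ)) •
          (XFilter.degSqrt G * XFilter.lipMatrix L * XFilter.degSqrt G) →
      XFilter.ParameterConditions G L σ β ∧
      XFilter.constTwo G σ β ≤
        128 * (96 * k / (∑ i, (G.degree i : ℝ)) * ∑ i, (G.degree i : ℝ) * L i + 19) ∧
      ∀ ε : ℝ, 0 < ε →
        XFilter.ReachesWithin f G σ β ε
          (1 / ε * XFilter.constOne f G L σ β * XFilter.constTwo G σ β *
            (1 / 4 * Real.log
              ((16 + 128 * (M : ℝ) *
                  max (XFilter.eigMax (XFilter.upsilonSq β * XFilter.filterMatrix G σ β)) 1) /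
                XFilter.thetaConst G σ β ^ 2) *
              Real.sqrt (1 / XFilter.eigRatio (XFilter.filterMatrix G σ β)))) ∧
        XFilter.ReachesWithin f G σ β ε
          (1 / ε * XFilter.constOne f G L σ β * XFilter.constTwo G σ β *
            (1 / 4 * Real.log
              (50 ^ 2 * ((M : ℝ) * XFilter.lipMax L / XFilter.lipMin L) ^ 4 *
                  (16 + 128 * (M : ℝ) * max (50 * 96 * k * XFilter.lipMax L) 1) /
                (XFilter.spectralGap (XFilter.tildeLaplacian G L) ^ 3 *
                  min 1 (96 ^ 2 * k ^ 2 * XFilter.lipMin L ^ 2 / (M : ℝ) ^ 2))) *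
              Real.sqrt (50 / XFilter.spectralGap (XFilter.tildeLaplacian G L))))) ∧
    -- Case II
    (XFilter.sigmaSq σ =
        (48 * 96 / ((M : ℝ) * XFilter.eigMinNonzero (XFilter.hatLaplacian G L))) •
          XFilter.edgeLip G L →
      XFilter.upsilonSq β = (96 / (M : ℝ)) • XFilter.lipMatrix L →
      XFilter.ParameterConditions G L σ β ∧
      XFilter.constTwo G σ β ≤ 128 * (96 / (M : ℝ) * ∑ i, L i + 19) ∧
      ∀ ε : ℝ, 0 < ε →
        XFilter.ReachesWithin f G σ β ε
          (1 / ε * XFilter.constOne f G L σ β * XFilter.constTwo G σ β *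
            (1 / 4 * Real.log
              (50 ^ 2 * (XFilter.lipMax L / XFilter.lipMin L) ^ 4 *
                  (16 + 128 * (M : ℝ) * max (50 * 96 * XFilter.lipMax L / (M : ℝ)) 1) /
                (XFilter.spectralGap (XFilter.hatLaplacian G L) ^ 3 *
                  min 1 (96 ^ 2 * XFilter.lipMin L ^ 2 / (M : ℝ) ^ 2))) *
              Real.sqrt (50 / XFilter.spectralGap (XFilter.hatLaplacian G L))))) := by

  have : Nonempty (Fin M) := ⟨⟨0, by omega⟩⟩
  have : Nontrivial (Fin M) := Fin.nontrivial_iff_two_le.2 hM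
  have hdeg : ∀ i, 1 ≤ G.degree i := fun i => hG.preconnected.degree_pos_of_nontrivial i
  obtain ⟨e⟩ : Nonempty G.edgeSet := by
    obtain ⟨j, hj⟩ := (G.degree_pos_iff_exists_adj (Classical.arbitrary (Fin M))).1 (hdeg _)
    exact ⟨⟨s(_, j), hj⟩⟩
  have hM0 : 0 < M := by omega
  have hM' : (0 : ℝ) < M := by exact_mod_cast hM0
  have hM1 : (1 : ℝ) ≤ M := by exact_mod_cast hM0
  have hL := hf.lip_pos
  have hmin := lipMin_pos hL
  have hmax : lipMin L ≤ lipMax L :=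
    (lipMin_le (Classical.arbitrary _)).trans (le_lipMax (Classical.arbitrary _))
  have hmax0 : 0 < lipMax L := hmin.trans_le hmax
  constructor
  · intro k hk hkP hsig hups
    set s := ∑ i, (G.degree i : ℝ) with hs
    have hds : ∀ i, (G.degree i : ℝ) ≤ s := fun i =>
      Finset.single_le_sum (f := fun i => (G.degree i : ℝ)) (fun _ _ => by positivity)
        (Finset.mem_univ i)
    have hd1 : ∀ i, (1 : ℝ) ≤ G.degree i := fun i => by exact_mod_cast hdeg i
    have hdM : ∀ i, (G.degree i : ℝ) ≤ M := fun i => by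
      have := (G.degree_lt_card_verts i).le
      rw [Fintype.card_fin] at this
      exact_mod_cast this
    have hs0 : 0 < s := lt_of_lt_of_le one_pos ((hd1 (Classical.arbitrary _)).trans (hds _))
    have hsM : s ≤ (M : ℝ) ^ 2 := by
      have := Finset.sum_le_card_nsmul Finset.univ (fun i => (G.degree i : ℝ)) M fun i _ => hdM i
      simpa [sq] using this
    set t := 96 * k / s with ht
    have ht0 : 0 < t := by positivity
    have hw : ∀ i, β i ^ 2 = t * (G.degree i * L i) := by
      intro i
      have h1 := congrFun (congrFun hups i) i
      rw [degSqrt, lipMatrix, diagonal_mul_diagonal, diagonal_mul_diagonal] at h1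
      simp only [upsilonSq, diagonal_apply_eq, Matrix.smul_apply, smul_eq_mul] at h1
      rw [h1, mul_right_comm (√_), Real.mul_self_sqrt (by positivity)]
    have hm : 0 < s * eigMinNonzero (tildeLaplacian G L) :=
      pos_of_sigmaSq_eq (by positivity) e (hσ e) hsig
    have hm0 : 0 < eigMinNonzero (tildeLaplacian G L) := pos_of_mul_pos_right hm hs0.le
    have hN : normLaplacian G σ β =
        (48 / eigMinNonzero (tildeLaplacian G L)) • tildeLaplacian G L := by
      rw [normLaplacian_eq_smul ht0 hβ hw hsig, ← tildeLaplacian_eq]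
      congr 1
      rw [ht]
      field_simp
    obtain ⟨hev, hb, hξ0, hξ1⟩ := eig_normLaplacian_of_eq_smul hm0 hN
    -- The diagonal of kP ⪰ d̄I reads k dᵢ ≥ (∑ dⱼ)/M.
    have hB : ∀ i, 96 / (M : ℝ) * L i ≤ β i ^ 2 := by
      intro i
      have h1 := hkP.diag_nonneg (i := i)
      simp only [Matrix.sub_apply, Matrix.smul_apply, degMatrix, diagonal_apply_eq, one_apply_eq,
        smul_eq_mul, mul_one, avgDegree, sub_nonneg] at h1
      rw [← hs, one_div_mul_eq_div, div_le_iff₀ hM'] at h1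
      rw [hw, ← mul_assoc]
      refine mul_le_mul_of_nonneg_right ?_ (hL i).le
      rw [ht, div_mul_eq_mul_div, div_le_div_iff₀ hM' hs0]
      linarith
    have hBmin : t * lipMin L ≤ eigMin (upsilonSq β) := by
      refine le_eigMin_upsilonSq fun i => ?_
      rw [hw]
      gcongr
      have := lipMin_le (L := L) i
      nlinarith [hd1 i, hL i]
    have hBmaxM : eigMax (upsilonSq β) ≤ t * (M * lipMax L) := by
      refine eigMax_upsilonSq_le fun i => ?_
      rw [hw]
      gcongr
      · exact (hL i).le
      · exact_mod_cast hdM i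
      · exact le_lipMax i
    have hBmaxs : eigMax (upsilonSq β) ≤ t * (s * lipMax L) := by
      refine eigMax_upsilonSq_le fun i => ?_
      rw [hw]
      gcongr
      · exact (hL i).le
      · exact hds i
      · exact le_lipMax i
    have hts : t * s = 96 * k := by rw [ht]; field_simp
    refine ⟨parameterConditions_of_normalized hM0 hL hβ hB hev, ?_, fun ε hε => ⟨?_, ?_⟩⟩
    · rw [constTwo_eq hev, Finset.sum_congr rfl fun i _ => hw i, ← Finset.mul_sum]
      linarith
    · refine reachesWithin_of_innerReal_le hM hf hβ hB hev hε ?_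
      change innerReal G σ β ≤ 2 * innerReal G σ β
      linarith [one_le_innerReal hM hβ hev]
    · refine reachesWithin_of_innerReal_le hM hf hβ hB hev hε ?_
      -- Here c = M: with ∑ dᵢ ≤ M² one gets λ_min(Υ²) ≥ 96kL_min/M², which has one more factor M in
      -- the denominator than the stated minimum.
      refine innerReal_le hM0 hβ hξ0 hξ1 hb hev hM1 ?_ ?_ ?_ (by positivity) (min_le_left _ _) ?_
      · rw [le_div_iff₀ hmin]
        gcongr
      · calc eigMax (upsilonSq β) ≤ t * (M * lipMax L) := hBmaxM
          _ = M * lipMax L / lipMin L * (t * lipMin L) := by field_simp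
          _ ≤ _ := by gcongr
      · calc 50 * eigMax (upsilonSq β) ≤ 50 * (t * (s * lipMax L)) := by gcongr
          _ = 50 * (t * s * lipMax L) := by ring
          _ = 50 * 96 * k * lipMax L := by rw [hts]; ring
          _ ≤ _ := le_rfl
      · rcases le_total 1 (eigMin (upsilonSq β)) with h | h
        · rw [min_eq_left h]
          refine (min_le_left _ _).trans ?_
          nlinarith
        · rw [min_eq_right h]
          refine (min_le_right _ _).trans ?_
          have h1 : 96 * k * lipMin L ≤ (M : ℝ) ^ 2 * eigMin (upsilonSq β) := by
            calc 96 * k * lipMin L = s * (t * lipMin L) := by rw [← hts]; ring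
              _ ≤ (M : ℝ) ^ 2 * eigMin (upsilonSq β) := by gcongr
          rw [div_le_iff₀ (by positivity)]
          calc 96 ^ 2 * k ^ 2 * lipMin L ^ 2 = (96 * k * lipMin L) ^ 2 := by ring
            _ ≤ ((M : ℝ) ^ 2 * eigMin (upsilonSq β)) ^ 2 := by gcongr
            _ = _ := by ring
  · intro hsig hups
    set t := 96 / (M : ℝ) with ht
    have ht0 : 0 < t := by positivity
    have hw : ∀ i, β i ^ 2 = t * L i := by
      intro i
      have h1 := congrFun (congrFun hups i) i
      simpa only [upsilonSq, lipMatrix, diagonal_apply_eq, Matrix.smul_apply, smul_eq_mul] using h1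
    have hm : 0 < (M : ℝ) * eigMinNonzero (hatLaplacian G L) :=
      pos_of_sigmaSq_eq (by positivity) e (hσ e) hsig
    have hm0 : 0 < eigMinNonzero (hatLaplacian G L) := pos_of_mul_pos_right hm hM'.le
    have hN : normLaplacian G σ β =
        (48 / eigMinNonzero (hatLaplacian G L)) • hatLaplacian G L := by
      rw [normLaplacian_eq_smul ht0 hβ hw hsig]
      change _ • hatLaplacian G L = _
      congr 1
      rw [ht]
      field_simp
    obtain ⟨hev, hb, hξ0, hξ1⟩ := eig_normLaplacian_of_eq_smul hm0 hN
    have hB : ∀ i, 96 / (M : ℝ) * L i ≤ β i ^ 2 := fun i => (hw i).ge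
    have hBmin : t * lipMin L ≤ eigMin (upsilonSq β) := by
      refine le_eigMin_upsilonSq fun i => ?_
      rw [hw]
      gcongr
      exact lipMin_le i
    have hBmax : eigMax (upsilonSq β) ≤ t * lipMax L := by
      refine eigMax_upsilonSq_le fun i => ?_
      rw [hw]
      gcongr
      exact le_lipMax i
    refine ⟨parameterConditions_of_normalized hM0 hL hβ hB hev, ?_, fun ε hε => ?_⟩
    · rw [constTwo_eq hev, Finset.sum_congr rfl fun i _ => hw i, ← Finset.mul_sum]
      linarith
    · refine reachesWithin_of_innerReal_le hM hf hβ hB hev hε ?_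
      -- Here c = 1, because λ_min(Υ²) ≥ 96L_min/M matches the stated minimum.
      refine innerReal_le hM0 hβ hξ0 hξ1 hb hev le_rfl ?_ ?_ ?_ (by positivity)
        (min_le_left _ _) ?_
      · rwa [one_le_div hmin]
      · calc eigMax (upsilonSq β) ≤ t * lipMax L := hBmax
          _ = lipMax L / lipMin L * (t * lipMin L) := by field_simp
          _ ≤ _ := by gcongr
      · calc 50 * eigMax (upsilonSq β) ≤ 50 * (t * lipMax L) := by gcongr
          _ = 50 * 96 * lipMax L / M := by rw [ht]; ring
          _ ≤ _ := le_rfl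
      · rw [one_pow, one_mul]
        rcases le_total 1 (eigMin (upsilonSq β)) with h | h
        · rw [min_eq_left h, one_pow]
          exact min_le_left _ _
        · rw [min_eq_right h]
          refine (min_le_right _ _).trans ?_
          calc 96 ^ 2 * lipMin L ^ 2 / (M : ℝ) ^ 2 = (t * lipMin L) ^ 2 := by rw [ht]; ring
            _ ≤ _ := by gcongr
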